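/- Let $I_1,I_2,I_3\subset\mathbb R$ be non-empty open intervals, let $D=\{(u,v,w): u\in I_1,\ v\in I_2,\ w\in I_3,\ 2w+v-u\ne 0\}$, and put $1/\rho=w+\tfrac12(v-u)$. Consider the system $$u_t=(v+w)u_x,\qquad v_t=(u-w)v_x,\qquad w_t=\tfrac12(u+v)w_x. \qquad (1)$$ Under the change of variables $u=-c+s-1/\rho$, $v=-c-s+1/\rho$, $w=s$ it is equivalent to the gas-dynamics equations $\rho_t+(\rho c)_x=0$, $c_t+cc_x+\rho^{-1}P_x=0$, $s_t+cs_x=0$ with $P=s-1/\rho$. For smooth functions $f(u)$, $\varphi(v)$, $\psi(w)$ on $I_1,I_2,I_3$ put $S=\frac12[f(u)+\varphi(v)+4\psi(w)]$ and $$w^1=-\tfrac12(2w+v-u)f'(u)-S,\quad w^2=\tfrac12(2w+v-u)\varphi'(v)-S,\quad w^3=(2w+v-u)\psi'(w)-S ,$$ and let $J_{f,\varphi,\psi}$ be the operator $$J=\frac{4}{\rho^2}\,\mathrm{diag}(f,\varphi,\psi)\frac{d}{dx} +\frac2\rho\begin{pmatrix}\frac1\rho f'u_x+2f(\frac1\rho)_x&-\varphi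 u_x-fv_x&-2\psi u_x-fw_x\\ \varphi u_x+fv_x&\frac1\rho\varphi'v_x+2\varphi(\frac1\rho)_x&-2\psi v_x+\varphi w_x\\ 2\psi u_x+fw_x&2\psi v_x-\varphi w_x&\frac1\rho\psi'w_x+2\psi(\frac1\rho)_x\end{pmatrix} +\begin{pmatrix}w^1u_x&u_x\\w^2v_x&v_x\\w^3w_x&w_x\end{pmatrix}\Big(\frac{d}{dx}\Big)^{-1} \begin{pmatrix}u_x&v_x&w_x\\w^1u_x&w^2v_x&w^3w_x\end{pmatrix}$$ on smooth fields $x\mapsto(u,v,w)\in D$. Then: 1. Every $J_{f,\varphi,\psi}$ is a Hamiltonian operator (skew-adjoint, with the Jacobi identity for the corresponding bracket), the flow $u_\tau=w^1u_x$, $v_\tau=w^2v_x$, $w_\tau=w^3w_x$ commutes with (1), all these operators are mutually compatible (linear combinations of any two are Hamiltonian), and different triples $(f,\varphi,\psi)$ give different operators. In particular there are infinitely many of them, including infinitely many with a nondegenerate metric (2) that is not flat. 2. If $f,\varphi,\psi$ have no zeros, then the local part of $J_{f,\varphi,\psi}$ is $g^{ij}\frac{d}{dx}-g^{is}\Gamma^j_{sk}u^k_x$,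 where $\Gamma$ is the Levi-Civita connection of the conformally flat metric $$(2w+v-u)^{-2}\left(\frac{du^2}{f(u)}+\frac{dv^2}{\varphi(v)}+\frac{dw^2}{\psi(w)}\right),\qquad (2)$$ and (1) is the Hamiltonian system $u^i_t=J^{ij}\,\partial h/\partial u^j$ with the density $h=\frac\rho8\big(\big[\int^u\frac{d\nu}{\sqrt{f(\nu)}}\big]^2-\big[\int^v\frac{d\nu}{\sqrt{\varphi(\nu)}}\big]^2\big)$, for any choice of the primitives (for a negative function $f$, $[\int d\nu/\sqrt{f}]^2$ means $-[\int d\nu/\sqrt{|f|}]^2$, and likewise for $\varphi$). Here $(d/dx)^{-1}$ of a total derivative $\frac{d}{dx}q(u,v,w)$ is $q(u,v,w)$ for a suitable choice of the additive constant in $q$. 3. If $f,\varphi,\psi$ have no zeros, the metric (2) is flat on $D$ if and only if $$f(u)=\varepsilon u+\alpha,\qquad \varphi(v)=-\varepsilon v+\beta,\qquad \psi(w)=-\tfrac{\varepsilon}{2}w+\gamma$$ for some constants $\varepsilon,\alpha,\beta,\gamma$ with $\alpha+\beta+4\gamma=0$. In this case $w^1=w^2=w^3=0$ on $D$, so that $J_{f,\varphi,\psi}$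 equals its local part; this local operator is Hamiltonian, and (1) is Hamiltonian with respect to it for some density. If $I_1,I_2,I_3$ are bounded, the local operators obtained in this way (with $f,\varphi,\psi$ without zeros) contain three linearly independent ones, and all of them are linear combinations of these three. -/

import Mathlib

open scoped ContDiff

noncomputable section

namespace HydroType

/-- Points `(u, v, w)` of the three-dimensional space of dependent variables. -/
abbrev Pt := Fin 3 → ℝ

/-- Partial derivative `∂F/∂u^k` at `p`. -/
def pd (k : Fin 3) (F : Pt → ℝ) (p : Pt) : ℝ :=
  fderiv ℝ F p (Pi.single k 1)

/-! ### Metrics, Levi-Civita connection, curvature -/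

/-- Christoffel symbols `Γ^k_{ij}` of the covariant metric `g`. -/
def christoffel (g : Pt → Matrix (Fin 3) (Fin 3) ℝ) (k i j : Fin 3) (p : Pt) : ℝ :=
  (1 / 2) * ∑ l, (g p)⁻¹ k l *
    (pd i (fun q => g q l j) p + pd j (fun q => g q l i) p - pd l (fun q => g q i j) p)

/-- Riemann curvature tensor `R^i_{jkl}` of the covariant metric `g`. -/
def riemann (g : Pt → Matrix (Fin 3) (Fin 3) ℝ) (i j k l : Fin 3) (p : Pt) : ℝ :=
  pd k (christoffel g i l j) p - pd l (christoffel g i k j) p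
    + ∑ m, (christoffel g i k m p * christoffel g m l j p
        - christoffel g i l m p * christoffel g m k j p)

/-- The metric `g` is flat on `D`. -/
def IsFlatOn (g : Pt → Matrix (Fin 3) (Fin 3) ℝ) (D : Set Pt) : Prop :=
  ∀ p ∈ D, ∀ i j k l, riemann g i j k l p = 0

/-- The metric `g` is conformally flat on `D`: near every point some smooth positive multiple
of it is flat. -/
def IsConformallyFlatOn (g : Pt → Matrix (Fin 3) (Fin 3) ℝ) (D : Set Pt) : Prop :=
  ∀ p ∈ D, ∃ V : Set Pt, IsOpen V ∧ p ∈ V ∧ V ⊆ D ∧ ∃ c : Pt → ℝ,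
    ContDiffOn ℝ ∞ c V ∧ (∀ q ∈ V, 0 < c q) ∧ IsFlatOn (fun q => c q • g q) V

/-! ### Fields, test covectors, operators -/

/-- A smooth field `x ↦ u(x)` with values in `D` (no condition at infinity). -/
def IsField (D : Set Pt) (u : ℝ → Pt) : Prop :=
  ContDiff ℝ ∞ u ∧ ∀ x, u x ∈ D

/-- A smooth compactly supported covector field along the line. -/
def IsTest (ξ : ℝ → Pt) : Prop :=
  ContDiff ℝ ∞ ξ ∧ HasCompactSupport ξ

/-- An operator depending on the field `u`, `T u ξ = J_u ξ`. -/
abbrev Op := (ℝ → Pt) → (ℝ → Pt) → (ℝ → Pt)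

/-- The bivector `∫ ξ_i (J_u η)^i dx`, that is, the bracket `{F_ξ, F_η}` at `u` of the
functionals `F_ξ[u] = ∫ ξ_i u^i dx` and `F_η[u] = ∫ η_i u^i dx`. -/
def pairing (T : Op) (u ξ η : ℝ → Pt) : ℝ :=
  ∫ x, ∑ i, ξ x i * T u η x i

/-- `T` is a Hamiltonian operator on the fields with values in `D`: it is skew-adjoint and the
bracket `{F, G} = ∫ (δF/δu) J (δG/δu) dx` satisfies the Jacobi identity (vanishing of the
Schouten trivector, `⟨ξ, J'[Jζ]η⟩ + cyclic = 0` for all `u` and all test covectors, where `J'[X]`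
is the derivative of `J` in the direction `X` of the field). -/
def IsHamiltonian (D : Set Pt) (T : Op) : Prop :=
  ∀ u, IsField D u →
    (∀ ξ, IsTest ξ → ContDiff ℝ ∞ (T u ξ)) ∧
    (∀ ξ η, IsTest ξ → IsTest η → pairing T u ξ η = -pairing T u η ξ) ∧
    ∀ ξ η ζ, IsTest ξ → IsTest η → IsTest ζ → ∃ a b c : ℝ,
      HasDerivAt (fun ε : ℝ => pairing T (fun x => u x + ε • T u ζ x) ξ η) a 0 ∧
      HasDerivAt (fun ε : ℝ => pairing T (fun x => u x + ε • T u ξ x) η ζ) b 0 ∧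
      HasDerivAt (fun ε : ℝ => pairing T (fun x => u x + ε • T u η x) ζ ξ) c 0 ∧
      a + b + c = 0

/-- Compatibility: all linear combinations are Hamiltonian operators. -/
def AreCompatible (D : Set Pt) (T T' : Op) : Prop :=
  ∀ c c' : ℝ, IsHamiltonian D (c • T + c' • T')

/-- The operator `T` as an honest family: one linear map on test covectors for each field. Two
operators are the same on `D` when their restrictions are equal. -/
def restrict (D : Set Pt) (T : Op) :
    {u : ℝ → Pt // IsField D u} → {ξ : ℝ → Pt // IsTest ξ} → ℝ → Pt :=
  fun u ξ => T u.1 ξ.1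

/-- The skew-symmetric inverse of `d/dx`. -/
def Dinv (s : ℝ → ℝ) (x : ℝ) : ℝ :=
  (1 / 2) * ((∫ y in Set.Iic x, s y) - ∫ y in Set.Ioi x, s y)

/-- The coefficients of an operator of hydrodynamic type
`J^{ij} = g^{ij}(u) d/dx + b^{ij}(u; u_x) + ∑_α L_α^i(u) u^i_x (d/dx)⁻¹ R_α^j(u) u^j_x`
with finitely many nonlocal terms given by diagonal affinors `L_α`, `R_α`. -/
structure HydroOp where
  /-- the contravariant metric `g^{ij}` -/
  metric : Pt → Matrix (Fin 3) (Fin 3) ℝ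
  /-- the term `b^{ij}(u; u_x)` of order zero; the second argument is `u_x` -/
  conn : Pt → Pt → Matrix (Fin 3) (Fin 3) ℝ
  /-- the number of nonlocal terms -/
  N : ℕ
  left : Fin N → Pt → Pt
  right : Fin N → Pt → Pt

namespace HydroOp

/-- The value of `J` on `ξ` when `K_α` is taken for `(d/dx)⁻¹ (R_α^j u^j_x ξ_j)`. -/
def act (J : HydroOp) (u ξ : ℝ → Pt) (K : Fin J.N → ℝ → ℝ) (x : ℝ) : Pt := fun i =>
  (∑ j, (J.metric (u x) i j * deriv ξ x j + J.conn (u x) (deriv u x) i j * ξ x j))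
    + ∑ α, J.left α (u x) i * deriv u x i * K α x

/-- The operator on test covectors, with the skew-symmetric `(d/dx)⁻¹`. -/
def toOp (J : HydroOp) : Op := fun u ξ =>
  J.act u ξ (fun α => Dinv (fun y => ∑ j, J.right α (u y) j * deriv u y j * ξ y j))

/-- The local part `g^{ij} d/dx + b^{ij}(u; u_x)`. -/
def localPart (J : HydroOp) : HydroOp where
  metric := J.metric
  conn := J.conn
  N := 0
  left := fun _ => 0
  right := fun _ => 0

/-- The local part of `J` is `g^{ij} d/dx - g^{is} Γ^j_{sk} u^k_x` for the Levi-Civita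
connection of the covariant metric `g`. -/
def IsGeneratedBy (J : HydroOp) (g : Pt → Matrix (Fin 3) (Fin 3) ℝ) (D : Set Pt) : Prop :=
  ∀ p ∈ D, IsUnit (g p).det ∧ (g p).IsSymm ∧ J.metric p = (g p)⁻¹ ∧
    ∀ (X : Pt) (i j : Fin 3),
      J.conn p X i j = -∑ s, ∑ k, (g p)⁻¹ i s * christoffel g j s k p * X k

end HydroOp

/-- The right-hand side `V^i(u) u^i_x` of the diagonal system `u^i_t = V^i(u) u^i_x`. -/
def flow (V : Pt → Pt) (u : ℝ → Pt) (x : ℝ) : Pt := fun i => V (u x) i * deriv u x i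

/-- The diagonal systems `u^i_t = V^i u^i_x` and `u^i_τ = W^i u^i_x` commute on `D`,
`u_{tτ} = u_{τt}`. -/
def FlowsCommute (D : Set Pt) (V W : Pt → Pt) : Prop :=
  ∀ u, IsField D u → ∀ x i, ∃ d : ℝ,
    HasDerivAt (fun ε : ℝ => flow V (fun y => u y + ε • flow W u y) x i) d 0 ∧
    HasDerivAt (fun ε : ℝ => flow W (fun y => u y + ε • flow V u y) x i) d 0

/-- The system `u^i_t = V^i(u) u^i_x` is `u_t = J ∂h/∂u` with the density `h(u)`. The expressions
`R_α^j u^j_x ∂h/∂u^j` are total derivatives of functions `q_α(u)`, and these are the values of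
`(d/dx)⁻¹` on them. -/
def IsHamiltonianSystem (D : Set Pt) (V : Pt → Pt) (J : HydroOp) (h : Pt → ℝ) : Prop :=
  ContDiffOn ℝ ∞ h D ∧ ∃ q : Fin J.N → Pt → ℝ,
    (∀ α, ContDiffOn ℝ ∞ (q α) D ∧ ∀ p ∈ D, ∀ k, pd k (q α) p = J.right α p k * pd k h p) ∧
    ∀ u, IsField D u → ∀ x,
      flow V u x = J.act u (fun y k => pd k h (u y)) (fun α y => q α (u y)) x

/-! ### The system `u_t = (v+w) u_x`, `v_t = (u-w) v_x`, `w_t = (u+v) w_x / 2` -/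

/-- Characteristic speeds of the system. -/
def speed (p : Pt) : Pt := ![p 1 + p 2, p 0 - p 2, (p 0 + p 1) / 2]

/-- The function `2w + v - u`, which is `2/ρ`. -/
def b (p : Pt) : ℝ := 2 * p 2 + p 1 - p 0

/-- The domain: `u ∈ I 0`, `v ∈ I 1`, `w ∈ I 2` and `2w + v - u ≠ 0`. -/
def dom (I : Fin 3 → Set ℝ) : Set Pt := {p | (∀ i, p i ∈ I i) ∧ b p ≠ 0}

/-- Parameters `f = F 0`, `φ = F 1`, `ψ = F 2`: smooth functions on the intervals `I i`. -/
def IsParam (I : Fin 3 → Set ℝ) (F : Fin 3 → ℝ → ℝ) : Prop :=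
  ∀ i, ContDiffOn ℝ ∞ (F i) (I i)

/-- Parameters without zeros, for which the metric is defined and nondegenerate. -/
def IsNondegParam (I : Fin 3 → Set ℝ) (F : Fin 3 → ℝ → ℝ) : Prop :=
  IsParam I F ∧ ∀ i, ∀ s ∈ I i, F i s ≠ 0

/-- The metric `(2w+v-u)⁻² (du²/f(u) + dv²/φ(v) + dw²/ψ(w))`. -/
def gasMetric (F : Fin 3 → ℝ → ℝ) (p : Pt) : Matrix (Fin 3) (Fin 3) ℝ :=
  Matrix.diagonal fun i => ((b p) ^ 2)⁻¹ * (F i (p i))⁻¹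

/-- The speeds `w¹, w², w³` of the nonlocal tail. -/
def tailSpeed (F : Fin 3 → ℝ → ℝ) (p : Pt) : Pt :=
  let S := (F 0 (p 0) + F 1 (p 1) + 4 * F 2 (p 2)) / 2
  ![-(b p / 2) * deriv (F 0) (p 0) - S,
    b p / 2 * deriv (F 1) (p 1) - S,
    b p * deriv (F 2) (p 2) - S]

/-- The nonlocal operator with the parameters `f, φ, ψ`. -/
def gasOp (F : Fin 3 → ℝ → ℝ) : HydroOp where
  metric p := Matrix.diagonal fun i => (b p) ^ 2 * F i (p i)
  conn p X :=
    let f := F 0 (p 0)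
    let φ := F 1 (p 1)
    let ψ := F 2 (p 2)
    let f' := deriv (F 0) (p 0)
    let φ' := deriv (F 1) (p 1)
    let ψ' := deriv (F 2) (p 2)
    let r := b p / 2
    let r_x := X 2 + (X 1 - X 0) / 2
    (b p) • !![r * f' * X 0 + 2 * f * r_x, -φ * X 0 - f * X 1, -2 * ψ * X 0 - f * X 2;
               φ * X 0 + f * X 1, r * φ' * X 1 + 2 * φ * r_x, -2 * ψ * X 1 + φ * X 2;
               2 * ψ * X 0 + f * X 2, 2 * ψ * X 1 - φ * X 2, r * ψ' * X 2 + 2 * ψ * r_x]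
  N := 2
  left := ![tailSpeed F, fun _ _ => 1]
  right := ![fun _ _ => 1, tailSpeed F]

/-- The density `(ρ/8) ([∫ du/√f]² - [∫ dv/√φ]²)`, `ρ = 2/(2w+v-u)`, where `A` and `B` are
primitives of `1/√|f|` and `1/√|φ|`; where `f < 0` the square of `∫ du/√f` is `-A²`. -/
def gasDensity (F : Fin 3 → ℝ → ℝ) (A B : ℝ → ℝ) (p : Pt) : ℝ :=
  (2 / b p) / 8 *
    (Real.sign (F 0 (p 0)) * A (p 0) ^ 2 - Real.sign (F 1 (p 1)) * B (p 1) ^ 2)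

/-- `f = εu + α`, `φ = -εv + β`, `ψ = -εw/2 + γ` with `α + β + 4γ = 0`. -/
def IsFlatParam (I : Fin 3 → Set ℝ) (F : Fin 3 → ℝ → ℝ) : Prop :=
  ∃ ε α β γ : ℝ, α + β + 4 * γ = 0 ∧
    (∀ s ∈ I 0, F 0 s = ε * s + α) ∧
    (∀ s ∈ I 1, F 1 s = -ε * s + β) ∧
    (∀ s ∈ I 2, F 2 s = -(ε / 2) * s + γ)

/-! ### Gas dynamics: functions of `z = (t, x)` -/

/-- `∂F/∂t` -/
def dt (F : ℝ × ℝ → ℝ) (z : ℝ × ℝ) : ℝ := fderiv ℝ F z (1, 0)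

/-- `∂F/∂x` -/
def dx (F : ℝ × ℝ → ℝ) (z : ℝ × ℝ) : ℝ := fderiv ℝ F z (0, 1)

/-- The equations of non-isentropic gas dynamics with pressure `P = s - 1/ρ` at `z`. -/
def GasEquations (ρ c s : ℝ × ℝ → ℝ) (z : ℝ × ℝ) : Prop :=
  dt ρ z + dx (fun y => ρ y * c y) z = 0 ∧
  dt c z + c z * dx c z + 1 / ρ z * dx (fun y => s y - 1 / ρ y) z = 0 ∧
  dt s z + c z * dx s z = 0

/-- The system in Riemann invariants at `z`. -/
def RiemannEquations (U : Fin 3 → ℝ × ℝ → ℝ) (z : ℝ × ℝ) : Prop :=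
  ∀ i, dt (U i) z = speed (fun j => U j z) i * dx (U i) z

end HydroType

end

open HydroType

open MeasureTheory Filter Topology

namespace HydroType

/-! ### The skew-symmetric inverse of `d/dx` -/

/-! Write `a = slope` for the gradient of the linear function `b = 2w + v - u`, `K` for `momentum`,
`H` for `tail` and `S` for `trail`. Everything rests on replacing a covector `ξ` by `ξ̂_i = b ξ_i +
a_i K`. In these terms `(Jξ)^i = b (F_i d/dx + (F_i)_x / 2) ξ̂_i + u^i_x M`, with the scalar `M = H
+ S K - ∑ a_j F_j ξ̂_j` (`toOp_gasOp`). The tail speeds are exactly those for which `M_x = -∑ a_j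
(F_j d/dx + (F_j)_x / 2) ξ̂_j` (`hasDerivAt_shift`).

Integration by parts then turns the bracket into `∫ ∑ F_i (ξ̂_i η̂_i' - ξ̂_i' η̂_i) / 2`
(`pairing_gasOp`). This is visibly skew. Since `ξ̂` is linear in the field and free of `F`, the
field enters nonlinearly only through `F_i(u^i)`. The variation of the bracket in a direction `X` is
therefore explicit, and after another integration by parts it contains neither `X_x` nor nonlocal
expressions in `X` (`integral_bracketVariation`). With `X = Jζ` the cyclic sum vanishes pointwise
(`variationRest_cyclic`), which is the Jacobi identity. As `J` is linear in `F`, compatibility is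
the Hamiltonian property for a combined parameter (`represents_sum`). Constant fields recover `F`
from `J`.

The metric is `b⁻²` times a product of one-dimensional metrics, and its sectional curvatures are
`w^i + w^j` (`riemann_gasMetric`). In dimension three flatness thus means `w = 0`, which separates
variables and makes the `F_i` affine.

For the density, `b h = (α(u) - β(v)) / 4` separates. Hence the transformed gradient is `∇(b h)`,
and `J ∇h` reduces to the ordinary differential equations `f α'' + f' α' / 2 = 2` and `φ β'' + φ' β'
/ 2 = 2`, solved by signed squares of `∫ 1/√|f|` and `∫ 1/√|φ|` (`isProfile_sq`,
`flow_speed_eq_act`). -/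

theorem Dinv_eq {s : ℝ → ℝ} (hs : Integrable s) (x : ℝ) :
    Dinv s x = (∫ y in Set.Iic 0, s y) + (∫ y in (0:ℝ)..x, s y) - (1 / 2) * ∫ y, s y := by
  have h1 : (∫ y in Set.Iic x, s y) - ∫ y in Set.Iic 0, s y = ∫ y in (0:ℝ)..x, s y :=
    intervalIntegral.integral_Iic_sub_Iic hs.integrableOn hs.integrableOn
  have h2 : (∫ y in Set.Iic x, s y) + ∫ y in Set.Ioi x, s y = ∫ y, s y :=
    intervalIntegral.integral_Iic_add_Ioi hs.integrableOn hs.integrableOn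
  unfold Dinv
  linarith

theorem hasDerivAt_Dinv {s : ℝ → ℝ} (hc : Continuous s) (hs : Integrable s) (x : ℝ) :
    HasDerivAt (Dinv s) (s x) x := by
  have h : Dinv s = fun x => (∫ y in Set.Iic 0, s y) + (∫ y in (0:ℝ)..x, s y)
      - (1 / 2) * ∫ y, s y := funext (Dinv_eq hs)
  rw [h]
  exact ((hc.integral_hasStrictDerivAt 0 x).hasDerivAt.const_add _).sub_const _

theorem contDiff_Dinv {s : ℝ → ℝ} (hc : ContDiff ℝ ∞ s) (hs : Integrable s) :
    ContDiff ℝ ∞ (Dinv s) := by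
  rw [contDiff_infty_iff_deriv]
  have h := hasDerivAt_Dinv hc.continuous hs
  exact ⟨fun x => (h x).differentiableAt, by rwa [show deriv (Dinv s) = s from
    funext fun x => (h x).deriv]⟩

theorem Dinv_add_smul {s t : ℝ → ℝ} (hs : Integrable s) (ht : Integrable t) (c x : ℝ) :
    Dinv (fun y => s y + c * t y) x = Dinv s x + c * Dinv t x := by
  unfold Dinv
  rw [integral_add hs.integrableOn (ht.const_mul c).integrableOn,
    integral_add hs.integrableOn (ht.const_mul c).integrableOn,
    integral_const_mul, integral_const_mul]
  ring

/-- At the ends of an interval that contains the support, `(d/dx)⁻¹ s` has opposite values. -/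
theorem Dinv_neg_end {s : ℝ → ℝ} {R : ℝ} (h : ∀ x, x ∉ Set.Ioo (-R) R → s x = 0) :
    Dinv s (-R) = -Dinv s R := by
  unfold Dinv
  have z1 : ∫ y in Set.Iic (-R), s y = 0 := setIntegral_eq_zero_of_forall_eq_zero fun x hx =>
    h x fun h' => absurd h'.1 (not_lt.2 hx)
  have z2 : ∫ y in Set.Ioi R, s y = 0 := setIntegral_eq_zero_of_forall_eq_zero fun x hx =>
    h x fun h' => absurd h'.2 (not_lt.2 (le_of_lt hx))
  have e1 : ∫ y in Set.Iic R, s y = ∫ y, s y := setIntegral_eq_integral_of_forall_compl_eq_zero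
    fun x hx => h x fun h' => hx (le_of_lt h'.2)
  have e2 : ∫ y in Set.Ioi (-R), s y = ∫ y, s y := setIntegral_eq_integral_of_forall_compl_eq_zero
    fun x hx => h x fun h' => hx h'.1
  rw [z1, z2, e1, e2]
  ring

/-! ### The symmetric form of the operator -/

/-- The coefficients of `2w + v - u`. -/
def slope : Fin 3 → ℝ := ![-1, 1, 2]

theorem b_eq (p : Pt) : b p = ∑ i, slope i * p i := by
  simp [b, slope, Fin.sum_univ_three]; ring

/-- `S = (f + φ + 4ψ)/2`. -/
noncomputable def trail (F : Fin 3 → ℝ → ℝ) (p : Pt) : ℝ := (1 / 2) * ∑ i, slope i ^ 2 * F i (p i)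

theorem tailSpeed_eq (F : Fin 3 → ℝ → ℝ) (p : Pt) (i : Fin 3) :
    tailSpeed F p i = b p / 2 * slope i * deriv (F i) (p i) - trail F p := by
  fin_cases i <;> simp [tailSpeed, trail, slope, Fin.sum_univ_three] <;> ring

/-- `K = (d/dx)⁻¹ (u^j_x ξ_j)`. -/
noncomputable def momentum (u ξ : ℝ → Pt) : ℝ → ℝ := Dinv fun y => ∑ j, deriv u y j * ξ y j

/-- `H = (d/dx)⁻¹ (w^j u^j_x ξ_j)`. -/
noncomputable def tail (F : Fin 3 → ℝ → ℝ) (u ξ : ℝ → Pt) : ℝ → ℝ :=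
  Dinv fun y => ∑ j, tailSpeed F (u y) j * deriv u y j * ξ y j

/-- The transformed covector `b ξ_i + a_i K`. -/
noncomputable def hat (u ξ : ℝ → Pt) (i : Fin 3) (x : ℝ) : ℝ := b (u x) * ξ x i + slope i * momentum u ξ x

/-- The derivative of `hat`. -/
noncomputable def hatD (u ξ : ℝ → Pt) (i : Fin 3) (x : ℝ) : ℝ :=
  b (deriv u x) * ξ x i + b (u x) * deriv ξ x i + slope i * ∑ j, deriv u x j * ξ x j

/-- The scalar operators `F_i d/dx + (F_i)_x / 2` on the transformed covector. -/
noncomputable def scalarPart (F : Fin 3 → ℝ → ℝ) (u ξ : ℝ → Pt) (i : Fin 3) (x : ℝ) : ℝ :=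
  F i (u x i) * hatD u ξ i x + (1 / 2) * (deriv (F i) (u x i) * deriv u x i) * hat u ξ i x

/-- The coefficient of `u_x` in the symmetric form of the operator. -/
noncomputable def shift (F : Fin 3 → ℝ → ℝ) (u ξ : ℝ → Pt) (x : ℝ) : ℝ :=
  tail F u ξ x + trail F (u x) * momentum u ξ x - ∑ j, slope j * F j (u x j) * hat u ξ j x

/-- The values `K` of `(d/dx)⁻¹` stay arbitrary, so that the formula serves both for test covectors,
with `Dinv`, and for gradients of a density, with potentials. -/
theorem act_gasOp (F : Fin 3 → ℝ → ℝ) (u ξ : ℝ → Pt) (K : Fin 2 → ℝ → ℝ) (x : ℝ) (i : Fin 3) :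
    (gasOp F).act u ξ K x i =
      b (u x) * (F i (u x i) * (b (deriv u x) * ξ x i + b (u x) * deriv ξ x i
          + slope i * ∑ j, deriv u x j * ξ x j)
        + (1 / 2) * (deriv (F i) (u x i) * deriv u x i) * (b (u x) * ξ x i + slope i * K 0 x))
      + deriv u x i * (K 1 x + trail F (u x) * K 0 x
        - ∑ j, slope j * F j (u x j) * (b (u x) * ξ x j + slope j * K 0 x)) := by
  have hb : b (deriv u x) = 2 * deriv u x 2 + deriv u x 1 - deriv u x 0 := rfl
  unfold HydroOp.act
  change _ + ∑ α : Fin 2, _ = _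
  rw [Fin.sum_univ_two]
  fin_cases i <;>
  simp [gasOp, Fin.sum_univ_three, tailSpeed_eq, trail, slope, Matrix.diagonal, hb] <;> ring

theorem toOp_gasOp (F : Fin 3 → ℝ → ℝ) (u ξ : ℝ → Pt) (x : ℝ) (i : Fin 3) :
    (gasOp F).toOp u ξ x i = b (u x) * scalarPart F u ξ i x + deriv u x i * shift F u ξ x := by
  have h := act_gasOp F u ξ ![momentum u ξ, tail F u ξ] x i
  have e : (gasOp F).toOp u ξ x i = (gasOp F).act u ξ ![momentum u ξ, tail F u ξ] x i := by
    unfold HydroOp.toOp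
    congr 2
    funext α
    change Fin 2 at α
    fin_cases α
    · simp only [gasOp, momentum]
      congr 1; funext y; simp
    · rfl
  rw [e, h]
  simp [scalarPart, shift, hat, hatD]

end HydroType

namespace HydroType

variable {I : Fin 3 → Set ℝ} {F : Fin 3 → ℝ → ℝ} {u ξ η ζ : ℝ → Pt} {R : ℝ}

/-! ### Smoothness -/

theorem contDiff_b : ContDiff ℝ ∞ b := by
  unfold b; fun_prop

theorem isOpen_dom (hI : ∀ i, IsOpen (I i)) : IsOpen (dom I) := by
  have h : dom I = (⋂ i, (fun p : Pt => p i) ⁻¹' I i) ∩ b ⁻¹' {0}ᶜ := by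
    ext p; simp [dom]
  rw [h]
  exact (isOpen_iInter_of_finite fun i => (hI i).preimage (continuous_apply i)).inter
    (isOpen_compl_singleton.preimage contDiff_b.continuous)

/-- Needed because the parameters are smooth only on the intervals, and a perturbed field may leave
the domain away from the support of the covector. -/
theorem contDiff_of_forall_tsupport {E : Type*} [NormedAddCommGroup E] [NormedSpace ℝ E]
    {f : ℝ → E} (h : ∀ x ∈ tsupport f, ContDiffAt ℝ ∞ f x) : ContDiff ℝ ∞ f := by
  rw [contDiff_iff_contDiffAt]
  intro x
  by_cases hx : x ∈ tsupport f
  · exact h x hx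
  · exact contDiffAt_const.congr_of_eventuallyEq (notMem_tsupport_iff_eventuallyEq.1 hx)

theorem IsParam.contDiffAt (hI : ∀ i, IsOpen (I i)) (hF : IsParam I F) {i : Fin 3} {s : ℝ}
    (hs : s ∈ I i) : ContDiffAt ℝ ∞ (F i) s :=
  (hF i).contDiffAt ((hI i).mem_nhds hs)

theorem IsParam.contDiffAt_deriv (hI : ∀ i, IsOpen (I i)) (hF : IsParam I F) {i : Fin 3} {s : ℝ}
    (hs : s ∈ I i) : ContDiffAt ℝ ∞ (deriv (F i)) s :=
  ((contDiffOn_infty_iff_deriv_of_isOpen (hI i)).1 (hF i)).2.contDiffAt ((hI i).mem_nhds hs)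

theorem IsParam.hasDerivAt (hI : ∀ i, IsOpen (I i)) (hF : IsParam I F) {i : Fin 3} {s : ℝ}
    (hs : s ∈ I i) : HasDerivAt (F i) (deriv (F i) s) s :=
  ((hF.contDiffAt hI hs).differentiableAt (by simp)).hasDerivAt

theorem contDiff_component (hu : ContDiff ℝ ∞ u) (i : Fin 3) : ContDiff ℝ ∞ fun y => u y i :=
  contDiff_pi.1 hu i

theorem contDiff_deriv_component (hu : ContDiff ℝ ∞ u) (i : Fin 3) :
    ContDiff ℝ ∞ fun y => deriv u y i :=
  contDiff_component (contDiff_infty_iff_deriv.1 hu).2 i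

theorem hasDerivAt_component (hu : ContDiff ℝ ∞ u) (i : Fin 3) (x : ℝ) :
    HasDerivAt (fun y => u y i) (deriv u x i) x :=
  hasDerivAt_pi.1 ((contDiff_infty_iff_deriv.1 hu).1 x).hasDerivAt i

theorem hasDerivAt_b (hu : ContDiff ℝ ∞ u) (x : ℝ) :
    HasDerivAt (fun y => b (u y)) (b (deriv u x)) x := by
  have h := fun i => hasDerivAt_component hu i x
  exact (((h 2).const_mul 2).add (h 1)).sub (h 0)

theorem hasDerivAt_param (hI : ∀ i, IsOpen (I i)) (hF : IsParam I F) (hu : ContDiff ℝ ∞ u)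
    {x : ℝ} (hx : u x ∈ dom I) (i : Fin 3) :
    HasDerivAt (fun y => F i (u y i)) (deriv (F i) (u x i) * deriv u x i) x :=
  (hF.hasDerivAt hI (hx.1 i)).comp x (hasDerivAt_component hu i x)

theorem contDiffAt_param (hI : ∀ i, IsOpen (I i)) (hF : IsParam I F) (hu : ContDiff ℝ ∞ u)
    {x : ℝ} (hx : u x ∈ dom I) (i : Fin 3) : ContDiffAt ℝ ∞ (fun y => F i (u y i)) x :=
  ContDiffAt.comp x (hF.contDiffAt hI (hx.1 i)) (contDiff_component hu i).contDiffAt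

theorem contDiffAt_deriv_param (hI : ∀ i, IsOpen (I i)) (hF : IsParam I F) (hu : ContDiff ℝ ∞ u)
    {x : ℝ} (hx : u x ∈ dom I) (i : Fin 3) : ContDiffAt ℝ ∞ (fun y => deriv (F i) (u y i)) x :=
  ContDiffAt.comp x (hF.contDiffAt_deriv hI (hx.1 i)) (contDiff_component hu i).contDiffAt

theorem contDiffAt_trail (hI : ∀ i, IsOpen (I i)) (hF : IsParam I F) (hu : ContDiff ℝ ∞ u)
    {x : ℝ} (hx : u x ∈ dom I) : ContDiffAt ℝ ∞ (fun y => trail F (u y)) x := by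
  unfold trail
  exact contDiffAt_const.mul (ContDiffAt.sum fun i _ =>
    contDiffAt_const.mul (contDiffAt_param hI hF hu hx i))

theorem contDiffAt_tailSpeed (hI : ∀ i, IsOpen (I i)) (hF : IsParam I F) (hu : ContDiff ℝ ∞ u)
    {x : ℝ} (hx : u x ∈ dom I) (i : Fin 3) : ContDiffAt ℝ ∞ (fun y => tailSpeed F (u y) i) x := by
  simp only [tailSpeed_eq]
  exact ((((contDiff_b.comp hu).contDiffAt.div_const 2).mul contDiffAt_const).mul
    (contDiffAt_deriv_param hI hF hu hx i)).sub (contDiffAt_trail hI hF hu hx)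

/-! ### The nonlocal ingredients -/

theorem tsupport_density_subset (c : Fin 3 → ℝ → ℝ) :
    tsupport (fun y => ∑ j, c j y * ξ y j) ⊆ tsupport ξ :=
  closure_mono fun y hy => by
    intro h
    exact hy (by simp [h])

theorem hasCompactSupport_density (hξ : IsTest ξ) (c : Fin 3 → ℝ → ℝ) :
    HasCompactSupport (fun y => ∑ j, c j y * ξ y j) :=
  hξ.2.mono' ((subset_tsupport _).trans (tsupport_density_subset c))

theorem contDiff_density (hξ : IsTest ξ) {c : Fin 3 → ℝ → ℝ}
    (hc : ∀ x ∈ tsupport ξ, ∀ j, ContDiffAt ℝ ∞ (c j) x) :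
    ContDiff ℝ ∞ (fun y => ∑ j, c j y * ξ y j) :=
  contDiff_of_forall_tsupport fun x hx => ContDiffAt.sum fun j _ =>
    (hc x (tsupport_density_subset c hx) j).mul (contDiff_component hξ.1 j).contDiffAt

theorem integrable_density (hξ : IsTest ξ) {c : Fin 3 → ℝ → ℝ}
    (hc : ∀ x ∈ tsupport ξ, ∀ j, ContDiffAt ℝ ∞ (c j) x) :
    Integrable (fun y => ∑ j, c j y * ξ y j) :=
  (contDiff_density hξ hc).continuous.integrable_of_hasCompactSupport
    (hasCompactSupport_density hξ c)

theorem hasDerivAt_Dinv_density (hξ : IsTest ξ) {c : Fin 3 → ℝ → ℝ}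
    (hc : ∀ x ∈ tsupport ξ, ∀ j, ContDiffAt ℝ ∞ (c j) x) (x : ℝ) :
    HasDerivAt (Dinv fun y => ∑ j, c j y * ξ y j) (∑ j, c j x * ξ x j) x :=
  hasDerivAt_Dinv (contDiff_density hξ hc).continuous (integrable_density hξ hc) x

theorem Dinv_density_neg_end (hξR : tsupport ξ ⊆ Set.Ioo (-R) R) (c : Fin 3 → ℝ → ℝ) :
    Dinv (fun y => ∑ j, c j y * ξ y j) (-R) = -Dinv (fun y => ∑ j, c j y * ξ y j) R :=
  Dinv_neg_end fun x hx => by simp [image_eq_zero_of_notMem_tsupport fun h => hx (hξR h)]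

theorem contDiff_momentum (hu : ContDiff ℝ ∞ u) (hξ : IsTest ξ) :
    ContDiff ℝ ∞ (momentum u ξ) :=
  have hc := fun x (_ : x ∈ tsupport ξ) j => (contDiff_deriv_component hu j).contDiffAt (x := x)
  contDiff_Dinv (contDiff_density hξ hc) (integrable_density hξ hc)

theorem hasDerivAt_momentum (hu : ContDiff ℝ ∞ u) (hξ : IsTest ξ) (x : ℝ) :
    HasDerivAt (momentum u ξ) (∑ j, deriv u x j * ξ x j) x :=
  hasDerivAt_Dinv_density hξ (fun _ _ j => (contDiff_deriv_component hu j).contDiffAt) x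

theorem contDiffAt_tail_coeff (hI : ∀ i, IsOpen (I i)) (hF : IsParam I F) (hu : ContDiff ℝ ∞ u)
    (hD : ∀ y ∈ tsupport ξ, u y ∈ dom I) :
    ∀ x ∈ tsupport ξ, ∀ j, ContDiffAt ℝ ∞ (fun y => tailSpeed F (u y) j * deriv u y j) x :=
  fun x hx j => (contDiffAt_tailSpeed hI hF hu (hD x hx) j).mul
    (contDiff_deriv_component hu j).contDiffAt

theorem contDiff_tail (hI : ∀ i, IsOpen (I i)) (hF : IsParam I F) (hu : ContDiff ℝ ∞ u)
    (hξ : IsTest ξ) (hD : ∀ y ∈ tsupport ξ, u y ∈ dom I) : ContDiff ℝ ∞ (tail F u ξ) :=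
  have hc := contDiffAt_tail_coeff hI hF hu hD
  contDiff_Dinv (contDiff_density hξ hc) (integrable_density hξ hc)

theorem hasDerivAt_tail (hI : ∀ i, IsOpen (I i)) (hF : IsParam I F) (hu : ContDiff ℝ ∞ u)
    (hξ : IsTest ξ) (hD : ∀ y ∈ tsupport ξ, u y ∈ dom I) (x : ℝ) :
    HasDerivAt (tail F u ξ) (∑ j, tailSpeed F (u x) j * deriv u x j * ξ x j) x :=
  hasDerivAt_Dinv_density hξ (contDiffAt_tail_coeff hI hF hu hD) x

theorem contDiff_hat (hu : ContDiff ℝ ∞ u) (hξ : IsTest ξ) (i : Fin 3) :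
    ContDiff ℝ ∞ (hat u ξ i) :=
  ((contDiff_b.comp hu).mul (contDiff_component hξ.1 i)).add
    (contDiff_const.mul (contDiff_momentum hu hξ))

theorem hasDerivAt_hat (hu : ContDiff ℝ ∞ u) (hξ : IsTest ξ) (i : Fin 3) (x : ℝ) :
    HasDerivAt (hat u ξ i) (hatD u ξ i x) x :=
  ((hasDerivAt_b hu x).mul (hasDerivAt_component hξ.1 i x)).add
    ((hasDerivAt_momentum hu hξ x).const_mul _)

theorem contDiff_hatD (hu : ContDiff ℝ ∞ u) (hξ : IsTest ξ) (i : Fin 3) :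
    ContDiff ℝ ∞ (hatD u ξ i) := by
  rw [← show deriv (hat u ξ i) = hatD u ξ i from
    funext fun x => (hasDerivAt_hat hu hξ i x).deriv]
  exact (contDiff_infty_iff_deriv.1 (contDiff_hat hu hξ i)).2

theorem contDiffAt_scalarPart (hI : ∀ i, IsOpen (I i)) (hF : IsParam I F) (hu : ContDiff ℝ ∞ u)
    (hξ : IsTest ξ) {x : ℝ} (hx : u x ∈ dom I) (i : Fin 3) :
    ContDiffAt ℝ ∞ (scalarPart F u ξ i) x :=
  ((contDiffAt_param hI hF hu hx i).mul (contDiff_hatD hu hξ i).contDiffAt).add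
    ((contDiffAt_const.mul ((contDiffAt_deriv_param hI hF hu hx i).mul
      (contDiff_deriv_component hu i).contDiffAt)).mul (contDiff_hat hu hξ i).contDiffAt)

theorem contDiffAt_shift (hI : ∀ i, IsOpen (I i)) (hF : IsParam I F) (hu : ContDiff ℝ ∞ u)
    (hξ : IsTest ξ) (hD : ∀ y ∈ tsupport ξ, u y ∈ dom I) {x : ℝ} (hx : u x ∈ dom I) :
    ContDiffAt ℝ ∞ (shift F u ξ) x :=
  ((contDiff_tail hI hF hu hξ hD).contDiffAt.add ((contDiffAt_trail hI hF hu hx).mul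
    (contDiff_momentum hu hξ).contDiffAt)).sub (ContDiffAt.sum fun i _ =>
    (contDiffAt_const.mul (contDiffAt_param hI hF hu hx i)).mul
      (contDiff_hat hu hξ i).contDiffAt)

theorem contDiffAt_toOp (hI : ∀ i, IsOpen (I i)) (hF : IsParam I F) (hu : ContDiff ℝ ∞ u)
    (hξ : IsTest ξ) (hD : ∀ y ∈ tsupport ξ, u y ∈ dom I) {x : ℝ} (hx : u x ∈ dom I) :
    ContDiffAt ℝ ∞ ((gasOp F).toOp u ξ) x := by
  rw [contDiffAt_pi]
  intro i
  simp only [toOp_gasOp]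
  exact ((contDiff_b.comp hu).contDiffAt.mul (contDiffAt_scalarPart hI hF hu hξ hx i)).add
    ((contDiff_deriv_component hu i).contDiffAt.mul (contDiffAt_shift hI hF hu hξ hD hx))

/-- The term `-S` of the tail speeds cancels `S K'`. The remaining part of `H'` combines with `S' K`
into `∑ a_j (F_j)_x ξ̂_j / 2`, which cancels half of the term with `(F_j)_x` coming from `∑ a_j F_j
ξ̂_j`. -/
theorem hasDerivAt_shift (hI : ∀ i, IsOpen (I i)) (hF : IsParam I F) (hu : ContDiff ℝ ∞ u)
    (hξ : IsTest ξ) (hD : ∀ y ∈ tsupport ξ, u y ∈ dom I) {x : ℝ} (hx : u x ∈ dom I) :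
    HasDerivAt (shift F u ξ) (-∑ j, slope j * scalarPart F u ξ j x) x := by
  have hS : HasDerivAt (fun y => trail F (u y))
      ((1 / 2) * ∑ i, slope i ^ 2 * (deriv (F i) (u x i) * deriv u x i)) x := by
    unfold trail
    exact (HasDerivAt.fun_sum fun i _ => (hasDerivAt_param hI hF hu hx i).const_mul _).const_mul _
  have h := ((hasDerivAt_tail hI hF hu hξ hD x).add (hS.mul (hasDerivAt_momentum hu hξ x))).sub
    (HasDerivAt.fun_sum (u := Finset.univ) fun i _ =>
      (((hasDerivAt_param hI hF hu hx i).const_mul (slope i)).mul (hasDerivAt_hat hu hξ i x)))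
  refine h.congr_deriv ?_
  simp only [tailSpeed_eq, scalarPart, hat, Fin.sum_univ_three, trail]
  ring

/-! ### The bracket -/

/-- The density of the bracket in the transformed covectors. -/
noncomputable def bracketDensity (F : Fin 3 → ℝ → ℝ) (u ξ η : ℝ → Pt) (x : ℝ) : ℝ :=
  ∑ i, F i (u x i) * ((1 / 2) * (hat u ξ i x * hatD u η i x - hatD u ξ i x * hat u η i x))

theorem pairing_gasOp (hI : ∀ i, IsOpen (I i)) (hF : IsParam I F) (hu : ContDiff ℝ ∞ u)
    (hξ : IsTest ξ) (hη : IsTest η) (hR : 0 ≤ R) (hξR : tsupport ξ ⊆ Set.Ioo (-R) R)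
    (hηR : tsupport η ⊆ Set.Ioo (-R) R) (hD : ∀ x ∈ Set.Icc (-R) R, u x ∈ dom I) :
    pairing (gasOp F).toOp u ξ η = ∫ x in -R..R, bracketDensity F u ξ η x := by
  have hDη : ∀ y ∈ tsupport η, u y ∈ dom I := fun y hy => hD y (Set.Ioo_subset_Icc_self (hηR hy))
  have hc1 : ContinuousOn (fun x => ∑ i, ξ x i * (gasOp F).toOp u η x i) (Set.uIcc (-R) R) := by
    rw [Set.uIcc_of_le (by linarith)]
    intro x hx
    exact (ContDiffAt.sum fun i _ => (contDiff_component hξ.1 i).contDiffAt.mul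
      (contDiffAt_pi.1 (contDiffAt_toOp hI hF hu hη hDη (hD x hx)) i)).continuousAt
      |>.continuousWithinAt
  have hc2 : ContinuousOn (bracketDensity F u ξ η) (Set.uIcc (-R) R) := by
    rw [Set.uIcc_of_le (by linarith)]
    intro x hx
    refine ContinuousAt.continuousWithinAt (ContDiffAt.continuousAt (n := ∞) (𝕜 := ℝ) ?_)
    exact ContDiffAt.sum fun i _ => (contDiffAt_param hI hF hu (hD x hx) i).mul
      (contDiffAt_const.mul (((contDiff_hat hu hξ i).mul (contDiff_hatD hu hη i)).sub
        ((contDiff_hatD hu hξ i).mul (contDiff_hat hu hη i))).contDiffAt)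
  have h0 : pairing (gasOp F).toOp u ξ η
      = ∫ x in -R..R, ∑ i, ξ x i * (gasOp F).toOp u η x i := by
    unfold pairing
    refine (intervalIntegral.integral_eq_integral_of_support_subset fun x hx => ?_).symm
    have : x ∈ tsupport ξ := by
      by_contra h
      exact hx (by simp [image_eq_zero_of_notMem_tsupport h])
    exact Set.Ioo_subset_Ioc_self (hξR this)
  -- the difference of the densities is a total derivative
  let Q : ℝ → ℝ := fun x => momentum u ξ x * shift F u η x
    + (1 / 2) * ∑ i, F i (u x i) * (hat u ξ i x * hat u η i x)
  have hQ : ∀ x ∈ Set.uIcc (-R) R, HasDerivAt Q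
      (∑ i, ξ x i * (gasOp F).toOp u η x i - bracketDensity F u ξ η x) x := by
    rw [Set.uIcc_of_le (by linarith)]
    intro x hx
    have h := ((hasDerivAt_momentum hu hξ x).mul (hasDerivAt_shift hI hF hu hη hDη (hD x hx))).add
      ((HasDerivAt.fun_sum (u := Finset.univ) fun i _ =>
        ((hasDerivAt_param hI hF hu (hD x hx) i).mul
          ((hasDerivAt_hat hu hξ i x).mul (hasDerivAt_hat hu hη i x)))).const_mul (1 / 2))
    refine h.congr_deriv ?_
    simp only [toOp_gasOp, bracketDensity, scalarPart, Fin.sum_univ_three, Pi.mul_apply]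
    simp only [hat, hatD, Fin.sum_univ_three]
    ring
  have hi := intervalIntegral.integral_eq_sub_of_hasDerivAt hQ (hc1.sub hc2).intervalIntegrable
  rw [intervalIntegral.integral_sub hc1.intervalIntegrable hc2.intervalIntegrable] at hi
  have hz : ∀ {ζ : ℝ → Pt}, tsupport ζ ⊆ Set.Ioo (-R) R → ζ R = 0 ∧ ζ (-R) = 0 := fun h =>
    ⟨image_eq_zero_of_notMem_tsupport fun h' => lt_irrefl _ (h h').2,
      image_eq_zero_of_notMem_tsupport fun h' => lt_irrefl _ (h h').1⟩
  -- At `±R` the covectors vanish, so `ξ̂_i = a_i K_ξ`. Since `∑ a_i² F_i = 2 S`, the terms with `S`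
  -- cancel and `Q = K_ξ H_η`. Both factors change sign between the ends, so the product does not.
  have hend : Q R - Q (-R) = 0 := by
    have k1 : momentum u ξ (-R) = -momentum u ξ R := Dinv_density_neg_end hξR _
    have k2 : momentum u η (-R) = -momentum u η R := Dinv_density_neg_end hηR _
    have k3 : tail F u η (-R) = -tail F u η R := Dinv_density_neg_end hηR _
    simp only [Q, shift, hat, trail, (hz hξR).1, (hz hξR).2, (hz hηR).1, (hz hηR).2, k1, k2, k3,
      Fin.sum_univ_three, Pi.zero_apply]
    ring
  rw [h0]
  linarith

theorem bracketDensity_swap (F : Fin 3 → ℝ → ℝ) (u ξ η : ℝ → Pt) (x : ℝ) :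
    bracketDensity F u ξ η x = -bracketDensity F u η ξ x := by
  simp only [bracketDensity, Fin.sum_univ_three]
  ring

end HydroType

namespace HydroType

variable {I : Fin 3 → Set ℝ} {F : Fin 3 → ℝ → ℝ} {u ξ η ζ X : ℝ → Pt} {R : ℝ}

/-! ### The derivative of the bracket along a variation of the field -/

/-- The direction `X = Jζ` need not have compact support, since `J` is nonlocal. Thus `u + ε X` can
be kept in the domain only over a compact interval. -/
theorem eventually_forall_mem_of_isOpen {E : Type*} [NormedAddCommGroup E] [NormedSpace ℝ E]
    {s : Set E} (hs : IsOpen s) {U V : ℝ → E} (hU : Continuous U) (hV : Continuous V)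
    (h : ∀ x ∈ Set.Icc (-R) R, U x ∈ s) :
    ∀ᶠ ε in 𝓝 (0:ℝ), ∀ x ∈ Set.Icc (-R) R, U x + ε • V x ∈ s := by
  refine isCompact_Icc.eventually_forall_of_forall_eventually fun x hx => ?_
  have hc : Continuous fun z : ℝ × ℝ => U z.2 + z.1 • V z.2 := by fun_prop
  exact hc.continuousAt.eventually_mem (hs.mem_nhds (by simpa using h x hx))

/-- Differentiation under the integral for one summand of the bracket density. The second factor is
a quadratic polynomial in `ε` because the transformed covectors are linear in the field. -/
theorem hasDerivAt_integral_param {s : Set ℝ} (hs : IsOpen s) {f : ℝ → ℝ}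
    (hf : ContDiffOn ℝ ∞ f s) {U V c₀ c₁ c₂ : ℝ → ℝ} (hU : Continuous U) (hV : Continuous V)
    (h₀ : Continuous c₀) (h₁ : Continuous c₁) (h₂ : Continuous c₂) (hR : 0 ≤ R)
    (h : ∀ x ∈ Set.Icc (-R) R, U x ∈ s) :
    IntervalIntegrable (fun x => deriv f (U x) * V x * c₀ x + f (U x) * c₁ x) volume (-R) R ∧
    HasDerivAt (fun ε : ℝ => ∫ x in -R..R, f (U x + ε * V x) * (c₀ x + ε * c₁ x + ε ^ 2 * c₂ x))
      (∫ x in -R..R, deriv f (U x) * V x * c₀ x + f (U x) * c₁ x) 0 := by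
  have hle : -R ≤ R := by linarith
  obtain ⟨δ, hδ, hball⟩ := Metric.eventually_nhds_iff_ball.1
    (eventually_forall_mem_of_isOpen hs hU hV h)
  simp only [smul_eq_mul] at hball
  -- Halving the radius gives a compact set of pairs `(ε, x)`, on which the continuous derivative
  -- has the bound required for domination.
  have hmem : ∀ z ∈ Metric.closedBall (0:ℝ) (δ / 2) ×ˢ Set.Icc (-R) R,
      U z.2 + z.1 * V z.2 ∈ s := fun z hz =>
    hball z.1 (Metric.closedBall_subset_ball (by linarith) hz.1) z.2 hz.2
  have hd : ContinuousOn (deriv f) s :=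
    ((contDiffOn_infty_iff_deriv_of_isOpen hs).1 hf).2.continuousOn
  have hin : ContinuousOn (fun z : ℝ × ℝ => U z.2 + z.1 * V z.2)
      (Metric.closedBall (0:ℝ) (δ / 2) ×ˢ Set.Icc (-R) R) :=
    Continuous.continuousOn (by fun_prop)
  let G : ℝ → ℝ → ℝ := fun ε x => f (U x + ε * V x) * (c₀ x + ε * c₁ x + ε ^ 2 * c₂ x)
  let G' : ℝ → ℝ → ℝ := fun ε x =>
    deriv f (U x + ε * V x) * V x * (c₀ x + ε * c₁ x + ε ^ 2 * c₂ x)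
      + f (U x + ε * V x) * (c₁ x + 2 * ε * c₂ x)
  have hG : ContinuousOn (fun z : ℝ × ℝ => G z.1 z.2)
      (Metric.closedBall (0:ℝ) (δ / 2) ×ˢ Set.Icc (-R) R) :=
    (hf.continuousOn.comp hin hmem).mul (Continuous.continuousOn (by fun_prop))
  have hG' : ContinuousOn (fun z : ℝ × ℝ => G' z.1 z.2)
      (Metric.closedBall (0:ℝ) (δ / 2) ×ˢ Set.Icc (-R) R) :=
    (((hd.comp hin hmem).mul (Continuous.continuousOn (by fun_prop))).mul
      (Continuous.continuousOn (by fun_prop))).add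
      ((hf.continuousOn.comp hin hmem).mul (Continuous.continuousOn (by fun_prop)))
  obtain ⟨C, hC⟩ := ((isCompact_closedBall (0:ℝ) (δ / 2)).prod
    (isCompact_Icc (a := -R) (b := R))).exists_bound_of_continuousOn hG'
  have hslice : ∀ {g : ℝ → ℝ → ℝ}, ContinuousOn (fun z : ℝ × ℝ => g z.1 z.2)
      (Metric.closedBall (0:ℝ) (δ / 2) ×ˢ Set.Icc (-R) R) → ∀ ε ∈ Metric.closedBall (0:ℝ) (δ / 2),
      ContinuousOn (g ε) (Set.uIcc (-R) R) := fun {g} hg ε hε => by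
    rw [Set.uIcc_of_le hle]
    exact hg.comp (f := fun x => (ε, x)) (by fun_prop) fun x hx => ⟨hε, hx⟩
  have h0 : (0:ℝ) ∈ Metric.closedBall (0:ℝ) (δ / 2) := Metric.mem_closedBall_self (by linarith)
  have hΙ : ∀ x ∈ Set.uIoc (-R) R, x ∈ Set.Icc (-R) R := fun x hx => by
    rw [Set.uIoc_of_le hle] at hx
    exact Set.Ioc_subset_Icc_self hx
  have key := intervalIntegral.hasDerivAt_integral_of_dominated_loc_of_deriv_le (μ := volume)
    (F := G) (F' := G') (a := -R) (b := R) (x₀ := 0) (bound := fun _ => C)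
    (Metric.closedBall_mem_nhds (0:ℝ) (half_pos hδ))
    (eventually_of_mem (Metric.closedBall_mem_nhds (0:ℝ) (half_pos hδ)) fun ε hε =>
      (hslice hG ε hε).intervalIntegrable.def'.aestronglyMeasurable)
    (hslice hG 0 h0).intervalIntegrable
    (hslice hG' 0 h0).intervalIntegrable.def'.aestronglyMeasurable
    (Eventually.of_forall fun x hx ε hε => hC (ε, x) ⟨hε, hΙ x hx⟩)
    intervalIntegrable_const
    (Eventually.of_forall fun x hx ε hε => by
      have hm : U x + ε * V x ∈ s := hmem (ε, x) ⟨hε, hΙ x hx⟩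
      have hfd : HasDerivAt f (deriv f (U x + ε * V x)) (U x + ε * V x) :=
        ((hf.contDiffAt (hs.mem_nhds hm)).differentiableAt (by simp)).hasDerivAt
      have hl : HasDerivAt (fun ε : ℝ => U x + ε * V x) (V x) ε := by
        simpa using ((hasDerivAt_id ε).mul_const (V x)).const_add (U x)
      have hp : HasDerivAt (fun ε : ℝ => c₀ x + ε * c₁ x + ε ^ 2 * c₂ x)
          (c₁ x + 2 * ε * c₂ x) ε := by
        refine ((((hasDerivAt_id ε).mul_const (c₁ x)).const_add (c₀ x)).add
          (((hasDerivAt_id ε).pow 2).mul_const (c₂ x))).congr_deriv ?_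
        simp
      exact (HasDerivAt.comp ε hfd hl).mul hp)
  have e : G' 0 = fun x => deriv f (U x) * V x * c₀ x + f (U x) * c₁ x := by
    funext x; simp [G']
  rw [e] at key
  exact key

theorem momentum_add_smul (hu : ContDiff ℝ ∞ u) (hX : ContDiff ℝ ∞ X) (hξ : IsTest ξ) (ε x : ℝ) :
    momentum (fun y => u y + ε • X y) ξ x = momentum u ξ x + ε * momentum X ξ x := by
  have hd : ∀ y, deriv (fun y => u y + ε • X y) y = deriv u y + ε • deriv X y := fun y =>
    (((contDiff_infty_iff_deriv.1 hu).1 y).hasDerivAt.add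
      (((contDiff_infty_iff_deriv.1 hX).1 y).hasDerivAt.const_smul ε)).deriv
  unfold momentum
  rw [← Dinv_add_smul (integrable_density hξ fun _ _ j => (contDiff_deriv_component hu j).contDiffAt)
    (integrable_density hξ fun _ _ j => (contDiff_deriv_component hX j).contDiffAt)]
  congr 1
  funext y
  simp only [hd, Fin.sum_univ_three, Pi.add_apply, Pi.smul_apply, smul_eq_mul]
  ring

theorem b_add_smul (p q : Pt) (ε : ℝ) : b (p + ε • q) = b p + ε * b q := by
  simp only [b, Pi.add_apply, Pi.smul_apply, smul_eq_mul]; ring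

/-- Both `b` and the momentum are linear in the field, the former because it has no constant term.
-/
theorem hat_add_smul (hu : ContDiff ℝ ∞ u) (hX : ContDiff ℝ ∞ X) (hξ : IsTest ξ) (ε : ℝ)
    (i : Fin 3) (x : ℝ) :
    hat (fun y => u y + ε • X y) ξ i x = hat u ξ i x + ε * hat X ξ i x := by
  simp only [hat, momentum_add_smul hu hX hξ, b_add_smul]
  ring

theorem hatD_add_smul (hu : ContDiff ℝ ∞ u) (hX : ContDiff ℝ ∞ X) (hξ : IsTest ξ) (ε : ℝ)
    (i : Fin 3) (x : ℝ) :
    hatD (fun y => u y + ε • X y) ξ i x = hatD u ξ i x + ε * hatD X ξ i x := by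
  have h := ((hasDerivAt_hat hu hξ i x).add ((hasDerivAt_hat hX hξ i x).const_mul ε))
  refine (hasDerivAt_hat (hu.add (hX.const_smul ε)) hξ i x).unique (h.congr_of_eventuallyEq ?_)
  exact Eventually.of_forall fun y => hat_add_smul hu hX hξ ε i y

/-- The derivative of `bracketDensity F u ξ η` in the direction `X` of the field `u`. -/
noncomputable def bracketVariation (F : Fin 3 → ℝ → ℝ) (u X ξ η : ℝ → Pt) (x : ℝ) : ℝ :=
  ∑ i, (deriv (F i) (u x i) * X x i
      * ((1 / 2) * (hat u ξ i x * hatD u η i x - hatD u ξ i x * hat u η i x))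
    + F i (u x i) * ((1 / 2) * (hat X ξ i x * hatD u η i x + hat u ξ i x * hatD X η i x
        - hatD X ξ i x * hat u η i x - hatD u ξ i x * hat X η i x)))

theorem hasDerivAt_pairing (hI : ∀ i, IsOpen (I i)) (hF : IsParam I F) (hu : ContDiff ℝ ∞ u)
    (hX : ContDiff ℝ ∞ X) (hξ : IsTest ξ) (hη : IsTest η) (hR : 0 ≤ R)
    (hξR : tsupport ξ ⊆ Set.Ioo (-R) R) (hηR : tsupport η ⊆ Set.Ioo (-R) R)
    (hD : ∀ x ∈ Set.Icc (-R) R, u x ∈ dom I) :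
    HasDerivAt (fun ε : ℝ => pairing (gasOp F).toOp (fun x => u x + ε • X x) ξ η)
      (∫ x in -R..R, bracketVariation F u X ξ η x) 0 := by
  have hc := fun {v θ : ℝ → Pt} (hv : ContDiff ℝ ∞ v) (hθ : IsTest θ) i =>
    (contDiff_hat hv hθ i).continuous
  have hc' := fun {v θ : ℝ → Pt} (hv : ContDiff ℝ ∞ v) (hθ : IsTest θ) i =>
    (contDiff_hatD hv hθ i).continuous
  have hpol : ∀ {v w : ℝ → Pt} (_ : ContDiff ℝ ∞ v) (_ : ContDiff ℝ ∞ w) (i : Fin 3), Continuous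
      fun x => hat v ξ i x * hatD w η i x - hatD v ξ i x * hat w η i x := fun hv hw i =>
    ((hc hv hξ i).mul (hc' hw hη i)).sub ((hc' hv hξ i).mul (hc hw hη i))
  have key := fun i : Fin 3 => hasDerivAt_integral_param (hI i) (hF i)
    (contDiff_component hu i).continuous (contDiff_component hX i).continuous
    (c₀ := fun x => (1 / 2) * (hat u ξ i x * hatD u η i x - hatD u ξ i x * hat u η i x))
    (c₁ := fun x => (1 / 2) * (hat X ξ i x * hatD u η i x + hat u ξ i x * hatD X η i x
        - hatD X ξ i x * hat u η i x - hatD u ξ i x * hat X η i x))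
    (c₂ := fun x => (1 / 2) * (hat X ξ i x * hatD X η i x - hatD X ξ i x * hat X η i x))
    (continuous_const.mul (hpol hu hu i))
    (continuous_const.mul ((((hc hX hξ i).mul (hc' hu hη i)).add
      ((hc hu hξ i).mul (hc' hX hη i))).sub ((hc' hX hξ i).mul (hc hu hη i)) |>.sub
        ((hc' hu hξ i).mul (hc hX hη i))))
    (continuous_const.mul (hpol hX hX i)) hR (fun x hx => (hD x hx).1 i)
  have hsum := HasDerivAt.fun_sum (u := Finset.univ) fun i _ => (key i).2
  rw [← intervalIntegral.integral_finsetSum fun i _ => (key i).1] at hsum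
  refine hsum.congr_of_eventuallyEq ?_
  have hdom := eventually_forall_mem_of_isOpen (isOpen_dom hI) hu.continuous hX.continuous hD
  filter_upwards [hdom] with ε hε
  have hin : ∀ i : Fin 3, IntervalIntegrable (fun x => F i (u x i + ε * X x i) *
      ((1 / 2) * (hat u ξ i x * hatD u η i x - hatD u ξ i x * hat u η i x) +
        ε * ((1 / 2) * (hat X ξ i x * hatD u η i x + hat u ξ i x * hatD X η i x
        - hatD X ξ i x * hat u η i x - hatD u ξ i x * hat X η i x)) +
        ε ^ 2 * ((1 / 2) * (hat X ξ i x * hatD X η i x - hatD X ξ i x * hat X η i x))))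
      volume (-R) R := by
    intro i
    apply ContinuousOn.intervalIntegrable
    rw [Set.uIcc_of_le (by linarith)]
    have k1 := hc hu hξ i
    have k2 := hc hX hξ i
    have k3 := hc hu hη i
    have k4 := hc hX hη i
    have k5 := hc' hu hξ i
    have k6 := hc' hX hξ i
    have k7 := hc' hu hη i
    have k8 := hc' hX hη i
    refine ContinuousOn.mul ((hF i).continuousOn.comp (f := fun x => u x i + ε * X x i)
      (Continuous.continuousOn ?_) fun x hx => (hε x hx).1 i) (Continuous.continuousOn ?_)
    · exact (contDiff_component hu i).continuous.add
        (continuous_const.mul (contDiff_component hX i).continuous)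
    · fun_prop
  rw [pairing_gasOp hI hF (hu.add (hX.const_smul ε)) hξ hη hR hξR hηR hε,
    ← intervalIntegral.integral_finsetSum fun i _ => hin i]
  congr 1
  funext x
  simp only [bracketDensity, hat_add_smul hu hX hξ, hat_add_smul hu hX hη,
    hatD_add_smul hu hX hξ, hatD_add_smul hu hX hη, Pi.add_apply, Pi.smul_apply, smul_eq_mul]
  refine Finset.sum_congr rfl fun i _ => ?_
  ring

/-! ### The Jacobi identity -/

/-- The variation of the bracket density up to a total derivative. -/
noncomputable def variationRest (F : Fin 3 → ℝ → ℝ) (u X ξ η : ℝ → Pt) (x : ℝ) : ℝ :=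
  ∑ i, deriv (F i) (u x i) * X x i
      * ((1 / 2) * (hat u ξ i x * hatD u η i x - hatD u ξ i x * hat u η i x))
    + (b (X x) * ∑ i, scalarPart F u η i x * ξ x i
      + (∑ i, slope i * scalarPart F u η i x) * ∑ i, X x i * ξ x i
      - shift F u η x * ∑ i, X x i * deriv ξ x i)
    - (b (X x) * ∑ i, scalarPart F u ξ i x * η x i
      + (∑ i, slope i * scalarPart F u ξ i x) * ∑ i, X x i * η x i
      - shift F u ξ x * ∑ i, X x i * deriv η x i)

/-- The derivatives of `hat X` are first moved to the other factor. The momentum of `X` then appears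
multiplied by `∑ a_j scalarPart_j = -M_x`, so a second integration by parts replaces it by `M ∑ X_x
ξ`, and a third removes `X_x`. What remains depends on `X` pointwise, so `X = Jζ` can be
substituted. -/
theorem integral_bracketVariation (hI : ∀ i, IsOpen (I i)) (hF : IsParam I F)
    (hu : ContDiff ℝ ∞ u) (hX : ContDiff ℝ ∞ X) (hξ : IsTest ξ) (hη : IsTest η) (hR : 0 ≤ R)
    (hξR : tsupport ξ ⊆ Set.Ioo (-R) R) (hηR : tsupport η ⊆ Set.Ioo (-R) R)
    (hD : ∀ x ∈ Set.Icc (-R) R, u x ∈ dom I) :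
    IntervalIntegrable (variationRest F u X ξ η) volume (-R) R ∧
    ∫ x in -R..R, bracketVariation F u X ξ η x = ∫ x in -R..R, variationRest F u X ξ η x := by
  have hDξ : ∀ y ∈ tsupport ξ, u y ∈ dom I := fun y hy => hD y (Set.Ioo_subset_Icc_self (hξR hy))
  have hDη : ∀ y ∈ tsupport η, u y ∈ dom I := fun y hy => hD y (Set.Ioo_subset_Icc_self (hηR hy))
  have hcont : ∀ {g : ℝ → ℝ}, (∀ x, u x ∈ dom I → ContDiffAt ℝ ∞ g x) →
      IntervalIntegrable g volume (-R) R := fun hg => by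
    apply ContinuousOn.intervalIntegrable
    rw [Set.uIcc_of_le (by linarith)]
    exact fun x hx => (hg x (hD x hx)).continuousAt.continuousWithinAt
  have hh := fun {v θ : ℝ → Pt} (hv : ContDiff ℝ ∞ v) (hθ : IsTest θ) i x =>
    (contDiff_hat hv hθ i).contDiffAt (x := x)
  have hh' := fun {v θ : ℝ → Pt} (hv : ContDiff ℝ ∞ v) (hθ : IsTest θ) i x =>
    (contDiff_hatD hv hθ i).contDiffAt (x := x)
  have hXi := fun i x => (contDiff_component hX i).contDiffAt (x := x)
  have hp := fun x (hx : u x ∈ dom I) i => contDiffAt_param hI hF hu hx i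
  have hp' := fun x (hx : u x ∈ dom I) i => contDiffAt_deriv_param hI hF hu hx i
  have hw : ∀ i x, u x ∈ dom I → ContDiffAt ℝ ∞ (fun x => deriv (F i) (u x i) * X x i
      * ((1 / 2) * (hat u ξ i x * hatD u η i x - hatD u ξ i x * hat u η i x))) x :=
    fun i x hx => ((hp' x hx i).mul (hXi i x)).mul (contDiffAt_const.mul
      (((hh hu hξ i x).mul (hh' hu hη i x)).sub ((hh' hu hξ i x).mul (hh hu hη i x))))
  have hv : ∀ x, u x ∈ dom I → ContDiffAt ℝ ∞ (bracketVariation F u X ξ η) x := fun x hx =>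
    ContDiffAt.sum fun i _ => (hw i x hx).add ((hp x hx i).mul (contDiffAt_const.mul
      (((((hh hX hξ i x).mul (hh' hu hη i x)).add ((hh hu hξ i x).mul (hh' hX hη i x))).sub
        ((hh' hX hξ i x).mul (hh hu hη i x))).sub ((hh' hu hξ i x).mul (hh hX hη i x)))))
  have hhalf : ∀ {θ θ' : ℝ → Pt}, IsTest θ → IsTest θ' → (∀ y ∈ tsupport θ', u y ∈ dom I) →
      ∀ x, u x ∈ dom I → ContDiffAt ℝ ∞ (fun x => b (X x) * ∑ i, scalarPart F u θ' i x * θ x i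
      + (∑ i, slope i * scalarPart F u θ' i x) * ∑ i, X x i * θ x i
      - shift F u θ' x * ∑ i, X x i * deriv θ x i) x := fun {θ θ'} hθ hθ' hDθ x hx => by
    have s1 := fun i => contDiffAt_scalarPart hI hF hu hθ' hx i
    have s2 := fun i => (contDiff_component hθ.1 i).contDiffAt (x := x)
    have s3 := fun i => (contDiff_deriv_component hθ.1 i).contDiffAt (x := x)
    exact (((contDiff_b.comp hX).contDiffAt.mul (ContDiffAt.sum fun i _ => (s1 i).mul (s2 i))).add
      ((ContDiffAt.sum fun i _ => contDiffAt_const.mul (s1 i)).mul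
        (ContDiffAt.sum fun i _ => (hXi i x).mul (s2 i)))).sub
      ((contDiffAt_shift hI hF hu hθ' hDθ hx).mul
        (ContDiffAt.sum fun i _ => (hXi i x).mul (s3 i)))
  have hr : ∀ x, u x ∈ dom I → ContDiffAt ℝ ∞ (variationRest F u X ξ η) x := fun x hx =>
    ((ContDiffAt.sum fun i _ => hw i x hx).add (hhalf hξ hη hDη x hx)).sub (hhalf hη hξ hDξ x hx)
  refine ⟨hcont hr, ?_⟩
  let Q : ℝ → ℝ := fun x =>
    (1 / 2) * ∑ i, F i (u x i) * (hat u ξ i x * hat X η i x - hat X ξ i x * hat u η i x)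
    + shift F u η x * (∑ i, X x i * ξ x i - momentum X ξ x)
    - shift F u ξ x * (∑ i, X x i * η x i - momentum X η x)
  have hQ : ∀ x ∈ Set.uIcc (-R) R, HasDerivAt Q
      (bracketVariation F u X ξ η x - variationRest F u X ξ η x) x := by
    rw [Set.uIcc_of_le (by linarith)]
    intro x hx
    have h := (((HasDerivAt.fun_sum (u := Finset.univ) fun i _ =>
      ((hasDerivAt_param hI hF hu (hD x hx) i).mul
        (((hasDerivAt_hat hu hξ i x).mul (hasDerivAt_hat hX hη i x)).sub
          ((hasDerivAt_hat hX hξ i x).mul (hasDerivAt_hat hu hη i x))))).const_mul (1 / 2)).add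
      ((hasDerivAt_shift hI hF hu hη hDη (hD x hx)).mul
        ((HasDerivAt.fun_sum (u := Finset.univ) fun i _ =>
          (hasDerivAt_component hX i x).mul (hasDerivAt_component hξ.1 i x)).sub
          (hasDerivAt_momentum hX hξ x)))).sub
      ((hasDerivAt_shift hI hF hu hξ hDξ (hD x hx)).mul
        ((HasDerivAt.fun_sum (u := Finset.univ) fun i _ =>
          (hasDerivAt_component hX i x).mul (hasDerivAt_component hη.1 i x)).sub
          (hasDerivAt_momentum hX hη x)))
    refine h.congr_deriv ?_
    have e1 : ∀ θ : ℝ → Pt, ∀ i, hat X θ i x = b (X x) * θ x i + slope i * momentum X θ x :=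
      fun _ _ => rfl
    have e2 : ∀ θ : ℝ → Pt, ∀ i, F i (u x i) * hatD u θ i x = scalarPart F u θ i x
        - (1 / 2) * (deriv (F i) (u x i) * deriv u x i) * hat u θ i x := fun θ i => by
      unfold scalarPart; ring
    simp only [bracketVariation, variationRest, Fin.sum_univ_three, Pi.sub_apply, Pi.mul_apply]
    linear_combination
      (-hat X ξ 0 x) * e2 η 0 - hat X ξ 1 x * e2 η 1 - hat X ξ 2 x * e2 η 2
      + hat X η 0 x * e2 ξ 0 + hat X η 1 x * e2 ξ 1 + hat X η 2 x * e2 ξ 2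
      - scalarPart F u η 0 x * e1 ξ 0 - scalarPart F u η 1 x * e1 ξ 1
      - scalarPart F u η 2 x * e1 ξ 2 + scalarPart F u ξ 0 x * e1 η 0
      + scalarPart F u ξ 1 x * e1 η 1 + scalarPart F u ξ 2 x * e1 η 2
  have hi := intervalIntegral.integral_eq_sub_of_hasDerivAt hQ ((hcont hv).sub (hcont hr))
  rw [intervalIntegral.integral_sub (hcont hv) (hcont hr)] at hi
  have hz : ∀ {ζ : ℝ → Pt}, tsupport ζ ⊆ Set.Ioo (-R) R → ζ R = 0 ∧ ζ (-R) = 0 := fun h =>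
    ⟨image_eq_zero_of_notMem_tsupport fun h' => lt_irrefl _ (h h').2,
      image_eq_zero_of_notMem_tsupport fun h' => lt_irrefl _ (h h').1⟩
  -- The terms with `S` cancel again, and at the ends `Q` is `H_ξ K_{X,η} - H_η K_{X,ξ}`, where
  -- `K_{X,η}` is the momentum of `η` along `X`. Each product takes equal values at `R` and `-R`.
  have hend : Q R - Q (-R) = 0 := by
    have k1 : momentum u ξ (-R) = -momentum u ξ R := Dinv_density_neg_end hξR _
    have k2 : momentum u η (-R) = -momentum u η R := Dinv_density_neg_end hηR _
    have k3 : tail F u η (-R) = -tail F u η R := Dinv_density_neg_end hηR _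
    have k4 : tail F u ξ (-R) = -tail F u ξ R := Dinv_density_neg_end hξR _
    have k5 : momentum X ξ (-R) = -momentum X ξ R := Dinv_density_neg_end hξR _
    have k6 : momentum X η (-R) = -momentum X η R := Dinv_density_neg_end hηR _
    simp only [Q, shift, hat, trail, (hz hξR).1, (hz hξR).2, (hz hηR).1, (hz hηR).2,
      k1, k2, k3, k4, k5, k6, Fin.sum_univ_three, Pi.zero_apply]
    ring
  linarith

theorem variationRest_cyclic (F : Fin 3 → ℝ → ℝ) (u ξ η ζ : ℝ → Pt) (x : ℝ) :
    variationRest F u ((gasOp F).toOp u ζ) ξ η x + variationRest F u ((gasOp F).toOp u ξ) η ζ x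
      + variationRest F u ((gasOp F).toOp u η) ζ ξ x = 0 := by
  -- the terms with `F_i'`, expressed through the scalar operators
  have e : ∀ (θ θ' θ'' : ℝ → Pt) (i : Fin 3), deriv (F i) (u x i) * (gasOp F).toOp u θ x i
      * ((1 / 2) * (hat u θ' i x * hatD u θ'' i x - hatD u θ' i x * hat u θ'' i x))
      = (1 / 2) * b (u x) * deriv (F i) (u x i) * scalarPart F u θ i x
          * (hat u θ' i x * hatD u θ'' i x - hatD u θ' i x * hat u θ'' i x)
        + shift F u θ x * (scalarPart F u θ' i x * hatD u θ'' i x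
          - scalarPart F u θ'' i x * hatD u θ' i x) := fun θ θ' θ'' i => by
    rw [toOp_gasOp]; simp only [scalarPart]; ring
  -- This is a vanishing determinant: each `scalarPart` is the same linear combination of `hat` and
  -- `hatD`.
  have c : ∀ i : Fin 3,
      scalarPart F u ζ i x * (hat u ξ i x * hatD u η i x - hatD u ξ i x * hat u η i x)
      + scalarPart F u ξ i x * (hat u η i x * hatD u ζ i x - hatD u η i x * hat u ζ i x)
      + scalarPart F u η i x * (hat u ζ i x * hatD u ξ i x - hatD u ζ i x * hat u ξ i x) = 0 :=
    fun i => by simp only [scalarPart]; ring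
  have h : ∀ (θ : ℝ → Pt) (i : Fin 3), hatD u θ i x =
      b (deriv u x) * θ x i + b (u x) * deriv θ x i + slope i * ∑ j, deriv u x j * θ x j :=
    fun _ _ => rfl
  simp only [variationRest, e, b_eq ((gasOp F).toOp u _ x)]
  simp only [Fin.sum_univ_three, toOp_gasOp]
  have hb := b_eq (deriv u x)
  rw [Fin.sum_univ_three] at hb
  generalize b (deriv u x) = bx at h hb
  simp only [Fin.sum_univ_three] at h
  subst hb
  -- The determinants `c` remove the terms with `F_i'` and a factor `b`. In the terms with a factor
  -- `shift`, expanding `hatD` makes everything cancel.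
  linear_combination
    (1 / 2) * b (u x) * (deriv (F 0) (u x 0) * c 0 + deriv (F 1) (u x 1) * c 1
      + deriv (F 2) (u x 2) * c 2)
    + shift F u ζ x
      * (scalarPart F u ξ 0 x * h η 0 - scalarPart F u η 0 x * h ξ 0)
    + shift F u ζ x
      * (scalarPart F u ξ 1 x * h η 1 - scalarPart F u η 1 x * h ξ 1)
    + shift F u ζ x
      * (scalarPart F u ξ 2 x * h η 2 - scalarPart F u η 2 x * h ξ 2)
    + shift F u ξ x
      * (scalarPart F u η 0 x * h ζ 0 - scalarPart F u ζ 0 x * h η 0)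
    + shift F u ξ x
      * (scalarPart F u η 1 x * h ζ 1 - scalarPart F u ζ 1 x * h η 1)
    + shift F u ξ x
      * (scalarPart F u η 2 x * h ζ 2 - scalarPart F u ζ 2 x * h η 2)
    + shift F u η x
      * (scalarPart F u ζ 0 x * h ξ 0 - scalarPart F u ξ 0 x * h ζ 0)
    + shift F u η x
      * (scalarPart F u ζ 1 x * h ξ 1 - scalarPart F u ξ 1 x * h ζ 1)
    + shift F u η x
      * (scalarPart F u ζ 2 x * h ξ 2 - scalarPart F u ξ 2 x * h ζ 2)

/-! ### Hamiltonian operators -/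

theorem exists_radius (hξ : IsTest ξ) (hη : IsTest η) (hζ : IsTest ζ) : ∃ R : ℝ, 0 ≤ R ∧
    tsupport ξ ⊆ Set.Ioo (-R) R ∧ tsupport η ⊆ Set.Ioo (-R) R ∧ tsupport ζ ⊆ Set.Ioo (-R) R := by
  obtain ⟨r, hr⟩ := ((hξ.2.isCompact.union hη.2.isCompact).union
    hζ.2.isCompact).isBounded.subset_ball_lt 0 0
  simp only [Real.ball_eq_Ioo, zero_sub, zero_add] at hr
  exact ⟨r, hr.1.le, fun x hx => hr.2 (Or.inl (Or.inl hx)), fun x hx => hr.2 (Or.inl (Or.inr hx)),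
    fun x hx => hr.2 (Or.inr hx)⟩

/-- `T` is the operator with the parameters `F`, as long as the values of the field that enter
are in `D`. -/
def Represents (I : Fin 3 → Set ℝ) (T : Op) (F : Fin 3 → ℝ → ℝ) : Prop :=
  ∀ u ξ, ContDiff ℝ ∞ u → IsTest ξ → (∀ y ∈ tsupport ξ, u y ∈ dom I) → ∀ x, u x ∈ dom I →
    T u ξ x = (gasOp F).toOp u ξ x

theorem Represents.pairing_eq {T : Op} (hT : Represents I T F) (hu : ContDiff ℝ ∞ u)
    (hη : IsTest η) (hDξ : ∀ y ∈ tsupport ξ, u y ∈ dom I)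
    (hDη : ∀ y ∈ tsupport η, u y ∈ dom I) :
    pairing T u ξ η = pairing (gasOp F).toOp u ξ η := by
  unfold pairing
  congr 1
  funext x
  by_cases hx : x ∈ tsupport ξ
  · rw [hT u η hu hη hDη x (hDξ x hx)]
  · simp [image_eq_zero_of_notMem_tsupport hx]

/-- Stated for any `T` that agrees with the operator, so that it also covers linear combinations
and, when the tail speeds vanish, the local part. -/
theorem Represents.isHamiltonian {T : Op} (hI : ∀ i, IsOpen (I i)) (hF : IsParam I F)
    (hT : Represents I T F) : IsHamiltonian (dom I) T := by
  intro u ⟨hu, hD⟩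
  have hTu : ∀ ξ, IsTest ξ → T u ξ = (gasOp F).toOp u ξ := fun ξ hξ => funext fun x =>
    hT u ξ hu hξ (fun y _ => hD y) x (hD x)
  have hsm : ∀ ξ, IsTest ξ → ContDiff ℝ ∞ ((gasOp F).toOp u ξ) := fun ξ hξ =>
    contDiff_iff_contDiffAt.2 fun x => contDiffAt_toOp hI hF hu hξ (fun y _ => hD y) (hD x)
  refine ⟨fun ξ hξ => hTu ξ hξ ▸ hsm ξ hξ, fun ξ η hξ hη => ?_, fun ξ η ζ hξ hη hζ => ?_⟩
  · obtain ⟨R, hR, hξR, hηR, -⟩ := exists_radius hξ hη hη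
    rw [hT.pairing_eq hu hη (fun y _ => hD y) fun y _ => hD y,
      hT.pairing_eq hu hξ (fun y _ => hD y) fun y _ => hD y,
      pairing_gasOp hI hF hu hξ hη hR hξR hηR fun x _ => hD x,
      pairing_gasOp hI hF hu hη hξ hR hηR hξR fun x _ => hD x, ← intervalIntegral.integral_neg]
    congr 1
    funext x
    exact bracketDensity_swap F u ξ η x
  · obtain ⟨R, hR, hξR, hηR, hζR⟩ := exists_radius hξ hη hζ
    have key : ∀ {θ θ' θ'' : ℝ → Pt}, IsTest θ → IsTest θ' → IsTest θ'' →
        tsupport θ' ⊆ Set.Ioo (-R) R → tsupport θ'' ⊆ Set.Ioo (-R) R →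
        HasDerivAt (fun ε : ℝ => pairing T (fun x => u x + ε • T u θ x) θ' θ'')
          (∫ x in -R..R, variationRest F u ((gasOp F).toOp u θ) θ' θ'' x) 0 ∧
        IntervalIntegrable (variationRest F u ((gasOp F).toOp u θ) θ' θ'') volume (-R) R := by
      intro θ θ' θ'' h h' h'' hR' hR''
      have hX := hsm θ h
      have hv := integral_bracketVariation hI hF hu hX h' h'' hR hR' hR'' fun x _ => hD x
      refine ⟨?_, hv.1⟩
      rw [hTu θ h, ← hv.2]
      refine (hasDerivAt_pairing hI hF hu hX h' h'' hR hR' hR''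
        fun x _ => hD x).congr_of_eventuallyEq ?_
      filter_upwards [eventually_forall_mem_of_isOpen (R := R) (isOpen_dom hI) hu.continuous
        hX.continuous fun x _ => hD x] with ε hε
      -- The perturbed field is known to be in the domain only on `[-R, R]`. This suffices, as the
      -- pairing sees it only on the two supports.
      exact hT.pairing_eq (hu.add (hX.const_smul ε)) h''
        (fun y hy => hε y (Set.Ioo_subset_Icc_self (hR' hy)))
        fun y hy => hε y (Set.Ioo_subset_Icc_self (hR'' hy))
    have k1 := key hζ hξ hη hξR hηR
    have k2 := key hξ hη hζ hηR hζR
    have k3 := key hη hζ hξ hζR hξR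
    refine ⟨_, _, _, k1.1, k2.1, k3.1, ?_⟩
    rw [← intervalIntegral.integral_add k1.2 k2.2,
      ← intervalIntegral.integral_add (k1.2.add k2.2) k3.2]
    simp [variationRest_cyclic]

theorem represents_gasOp (F : Fin 3 → ℝ → ℝ) : Represents I (gasOp F).toOp F :=
  fun _ _ _ _ _ _ _ => rfl

end HydroType

namespace HydroType

variable {I : Fin 3 → Set ℝ} {F G : Fin 3 → ℝ → ℝ} {u ξ : ℝ → Pt}

/-! ### Linear combinations -/

theorem Dinv_sum {ι : Type*} [Fintype ι] {s : ι → ℝ → ℝ} (hs : ∀ m, Integrable (s m))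
    (c : ι → ℝ) (x : ℝ) :
    Dinv (fun y => ∑ m, c m * s m y) x = ∑ m, c m * Dinv (s m) x := by
  unfold Dinv
  rw [integral_finsetSum _ fun m _ => ((hs m).const_mul (c m)).integrableOn,
    integral_finsetSum _ fun m _ => ((hs m).const_mul (c m)).integrableOn,
    ← Finset.sum_sub_distrib, Finset.mul_sum]
  refine Finset.sum_congr rfl fun m _ => ?_
  rw [integral_const_mul, integral_const_mul]
  ring

/-- All ingredients are linear in the pair `(F, F')`, so the family is closed under linear
combinations. -/
theorem represents_sum {ι : Type*} [Fintype ι] (hI : ∀ i, IsOpen (I i)) (c : ι → ℝ)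
    {G : ι → Fin 3 → ℝ → ℝ} (hG : ∀ m, IsParam I (G m))
    (hF : ∀ i, Set.EqOn (F i) (fun s => ∑ m, c m * G m i s) (I i)) :
    Represents I (∑ m, c m • (gasOp (G m)).toOp) F := by
  intro u ξ hu hξ hD x hx
  have h0 : ∀ y, u y ∈ dom I → ∀ i, F i (u y i) = ∑ m, c m * G m i (u y i) :=
    fun y hy i => hF i (hy.1 i)
  have h1 : ∀ y, u y ∈ dom I → ∀ i, deriv (F i) (u y i) = ∑ m, c m * deriv (G m i) (u y i) := by
    intro y hy i
    have h := HasDerivAt.fun_sum (u := Finset.univ) fun m _ =>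
      ((hG m).hasDerivAt hI (hy.1 i)).const_mul (c m)
    exact (h.congr_of_eventuallyEq ((hF i).eventuallyEq_of_mem ((hI i).mem_nhds (hy.1 i)))).deriv
  have htr : ∀ y, u y ∈ dom I → trail F (u y) = ∑ m, c m * trail (G m) (u y) := by
    intro y hy
    simp only [trail, h0 y hy, Fin.sum_univ_three, Finset.mul_sum, ← Finset.sum_add_distrib]
    exact Finset.sum_congr rfl fun m _ => by ring
  have hw : ∀ y, u y ∈ dom I → ∀ i, tailSpeed F (u y) i = ∑ m, c m * tailSpeed (G m) (u y) i := by
    intro y hy i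
    simp only [tailSpeed_eq, h1 y hy, htr y hy, Finset.mul_sum, ← Finset.sum_sub_distrib]
    exact Finset.sum_congr rfl fun m _ => by ring
  have htail : tail F u ξ x = ∑ m, c m * tail (G m) u ξ x := by
    unfold tail
    rw [← Dinv_sum fun m => integrable_density hξ (contDiffAt_tail_coeff hI (hG m) hu hD)]
    congr 1
    funext y
    by_cases hy : y ∈ tsupport ξ
    · simp only [hw y (hD y hy), Fin.sum_univ_three, Finset.sum_mul, ← Finset.sum_add_distrib]
      exact Finset.sum_congr rfl fun m _ => by ring
    · simp [image_eq_zero_of_notMem_tsupport hy]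
  have hsc : ∀ i, scalarPart F u ξ i x = ∑ m, c m * scalarPart (G m) u ξ i x := by
    intro i
    simp only [scalarPart, h0 x hx, h1 x hx, Finset.sum_mul, Finset.mul_sum,
      ← Finset.sum_add_distrib]
    exact Finset.sum_congr rfl fun m _ => by ring
  have hsh : shift F u ξ x = ∑ m, c m * shift (G m) u ξ x := by
    simp only [shift, h0 x hx, htail, htr x hx, Fin.sum_univ_three, Finset.sum_mul,
      Finset.mul_sum, ← Finset.sum_add_distrib, ← Finset.sum_sub_distrib]
    exact Finset.sum_congr rfl fun m _ => by ring
  funext i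
  simp only [Finset.sum_apply, Pi.smul_apply, smul_eq_mul, toOp_gasOp, hsc, hsh, Finset.mul_sum,
    ← Finset.sum_add_distrib]
  exact Finset.sum_congr rfl fun m _ => by ring

theorem isParam_sum {ι : Type*} [Fintype ι] (c : ι → ℝ) {G : ι → Fin 3 → ℝ → ℝ}
    (hG : ∀ m, IsParam I (G m)) : IsParam I fun i s => ∑ m, c m * G m i s :=
  fun i => ContDiffOn.sum fun m _ => contDiffOn_const.mul (hG m i)

theorem areCompatible_gasOp (hI : ∀ i, IsOpen (I i)) (hF : IsParam I F) (hG : IsParam I G) :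
    AreCompatible (dom I) (gasOp F).toOp (gasOp G).toOp := by
  intro c c'
  have hFG : ∀ m, IsParam I ((![F, G] : Fin 2 → Fin 3 → ℝ → ℝ) m) := by
    intro m; fin_cases m
    · exact hF
    · exact hG
  have h := (represents_sum hI ![c, c'] hFG fun i s _ => rfl).isHamiltonian hI (isParam_sum _ hFG)
  rwa [Fin.sum_univ_two] at h

theorem Represents.restrict_eq {T : Op} (hT : Represents I T F) :
    restrict (dom I) T = restrict (dom I) (gasOp F).toOp :=
  funext fun u => funext fun ξ => funext fun x =>
    hT u.1 ξ.1 u.2.1 ξ.2 (fun y _ => u.2.2 y) x (u.2.2 x)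

theorem sum_smul_restrict {ι : Type*} [Fintype ι] (D : Set Pt) (c : ι → ℝ) (T : ι → Op) :
    ∑ m, c m • restrict D (T m) = restrict D (∑ m, c m • T m) := by
  funext u ξ
  simp [restrict, Finset.sum_apply]

/-! ### Points of the domain -/

/-- All three slopes are nonzero, so moving any single coordinate leaves the plane `b = 0`. -/
theorem exists_update_mem_dom (hI : ∀ i, IsOpen (I i)) {p : Pt} (hp : ∀ i, p i ∈ I i)
    (j : Fin 3) : ∃ t, Function.update p j t ∈ dom I := by
  have hmem : ∀ t ∈ I j, ∀ i, Function.update p j t i ∈ I i := by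
    intro t ht i
    rcases eq_or_ne i j with rfl | h
    · simpa using ht
    · simpa [h] using hp i
  by_cases h : b p = 0
  · obtain ⟨t, ht, hne⟩ : ∃ t ∈ I j, t ≠ p j := by
      obtain ⟨t, ht⟩ := Filter.nonempty_of_mem (inter_mem (mem_nhdsWithin_of_mem_nhds ((hI j).mem_nhds (hp j)))
        (self_mem_nhdsWithin (a := p j) (s := {p j}ᶜ)))
      exact ⟨t, ht.1, ht.2⟩
    refine ⟨t, hmem t ht, fun h' => hne ?_⟩
    rw [b_eq, Fin.sum_univ_three] at h h'
    fin_cases j <;> simp [slope, Function.update] at h h' ⊢ <;> linarith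
  · exact ⟨p j, hmem _ (hp j), by rwa [Function.update_eq_self]⟩

theorem exists_mem_dom_pair (hI : ∀ i, IsOpen (I i)) (hne : ∀ i, (I i).Nonempty) {i j : Fin 3}
    (hij : i ≠ j) {s t : ℝ} (hs : s ∈ I i) (ht : t ∈ I j) : ∃ p ∈ dom I, p i = s ∧ p j = t := by
  choose q hq using hne
  obtain ⟨k, hki, hkj⟩ : ∃ k : Fin 3, k ≠ i ∧ k ≠ j := by
    clear hs ht; revert i j; decide
  have hp : ∀ l, Function.update (Function.update q i s) j t l ∈ I l := by
    intro l
    by_cases h1 : l = j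
    · subst h1; simpa using ht
    · by_cases h2 : l = i
      · subst h2; simpa [h1] using hs
      · simpa [h1, h2] using hq l
  obtain ⟨r, hr⟩ := exists_update_mem_dom hI hp k
  exact ⟨_, hr, by simp [hki.symm, hij], by simp [hkj.symm]⟩

theorem exists_mem_dom (hI : ∀ i, IsOpen (I i)) (hne : ∀ i, (I i).Nonempty) {i : Fin 3} {s : ℝ}
    (hs : s ∈ I i) : ∃ p ∈ dom I, p i = s := by
  obtain ⟨j, hj⟩ : ∃ j : Fin 3, i ≠ j := by clear hs; revert i; decide
  obtain ⟨t, ht⟩ := hne j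
  obtain ⟨p, hp, h, -⟩ := exists_mem_dom_pair hI hne hj hs ht
  exact ⟨p, hp, h⟩

/-! ### Different parameters give different operators -/

theorem exists_isTest_deriv_eq_one : ∃ ξ : ℝ → Pt, IsTest ξ ∧ ∀ i, deriv ξ 0 i = 1 := by
  let φ : ContDiffBump (0:ℝ) := ⟨1, 2, by norm_num, by norm_num⟩
  have hφ : ContDiff ℝ ∞ φ := φ.contDiff
  refine ⟨fun y _ => y * φ y, ⟨contDiff_pi.2 fun _ => contDiff_id.mul hφ, ?_⟩, fun i => ?_⟩
  · refine φ.hasCompactSupport.mono fun y hy => ?_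
    intro h
    exact hy (by funext i; simp [h])
  · have h : HasDerivAt (fun y : ℝ => y * φ y) 1 0 := by
      have h1 := (hasDerivAt_id (0:ℝ)).mul (hφ.differentiable (by simp) 0).hasDerivAt
      have h2 : φ 0 = 1 := φ.one_of_mem_closedBall (by simp [φ])
      exact h1.congr_deriv (by simp [h2])
    have h' : HasDerivAt (fun (y : ℝ) (_ : Fin 3) => y * φ y) (fun _ => 1) 0 :=
      hasDerivAt_pi.2 fun _ => h
    rw [h'.deriv]

theorem isField_const {D : Set Pt} {p : Pt} (hp : p ∈ D) : IsField D fun _ => p :=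
  ⟨contDiff_const, fun _ => hp⟩

theorem toOp_gasOp_const (F : Fin 3 → ℝ → ℝ) (p : Pt) (ξ : ℝ → Pt) (x : ℝ) (i : Fin 3) :
    (gasOp F).toOp (fun _ => p) ξ x i = b p ^ 2 * F i (p i) * deriv ξ x i := by
  have h0 : b 0 = 0 := by simp [b]
  simp [toOp_gasOp, scalarPart, hatD, h0]
  ring

/-- On a constant field only `b² F_i d/dx` survives, and a test covector with unit derivative at a
point reads off `F_i`. -/
theorem eqOn_of_restrict_eq (hI : ∀ i, IsOpen (I i)) (hne : ∀ i, (I i).Nonempty)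
    (h : restrict (dom I) (gasOp F).toOp = restrict (dom I) (gasOp G).toOp) (i : Fin 3) :
    Set.EqOn (F i) (G i) (I i) := by
  intro s hs
  obtain ⟨p, hp, rfl⟩ := exists_mem_dom hI hne hs
  obtain ⟨ξ, hξ, h1⟩ := exists_isTest_deriv_eq_one
  have h2 := congrFun (congrFun (congrFun (congrFun h ⟨_, isField_const hp⟩) ⟨ξ, hξ⟩) 0) i
  simp only [restrict, toOp_gasOp_const, h1, mul_one] at h2
  exact mul_left_cancel₀ (pow_ne_zero 2 hp.2) h2

/-! ### Commuting flows -/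

theorem hasDerivAt_tailSpeed_comp (hI : ∀ i, IsOpen (I i)) (hF : IsParam I F) {γ : ℝ → Pt} {q : Pt}
    {t : ℝ} (hγ : HasDerivAt γ q t) (ht : γ t ∈ dom I) (i : Fin 3) :
    HasDerivAt (fun ε => tailSpeed F (γ ε) i)
      (b q / 2 * slope i * deriv (F i) (γ t i)
        + b (γ t) / 2 * slope i * (deriv (deriv (F i)) (γ t i) * q i)
        - (1 / 2) * ∑ j, slope j ^ 2 * (deriv (F j) (γ t j) * q j)) t := by
  have h := hasDerivAt_pi.1 hγ
  have hb : HasDerivAt (fun ε => b (γ ε)) (b q) t := (((h 2).const_mul 2).add (h 1)).sub (h 0)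
  have h1 : ∀ j, HasDerivAt (fun ε => F j (γ ε j)) (deriv (F j) (γ t j) * q j) t := fun j =>
    (hF.hasDerivAt hI (ht.1 j)).comp t (h j)
  have h2 : HasDerivAt (fun ε => deriv (F i) (γ ε i)) (deriv (deriv (F i)) (γ t i) * q i) t :=
    HasDerivAt.comp (h₂ := deriv (F i)) t
      ((hF.contDiffAt_deriv hI (ht.1 i)).differentiableAt (by simp)).hasDerivAt (h i)
  simp only [tailSpeed_eq, trail]
  exact (((hb.div_const 2).mul_const (slope i)).mul h2).sub
    ((HasDerivAt.fun_sum fun j _ => (h1 j).const_mul (slope j ^ 2)).const_mul (1 / 2))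

theorem hasDerivAt_speed_comp {γ : ℝ → Pt} {q : Pt} {t : ℝ} (hγ : HasDerivAt γ q t) (i : Fin 3) :
    HasDerivAt (fun ε => speed (γ ε) i) (speed q i) t := by
  have h := hasDerivAt_pi.1 hγ
  fin_cases i
  · exact (h 1).add (h 2)
  · exact (h 0).sub (h 2)
  · exact ((h 0).add (h 1)).div_const 2

/-- For `i ≠ j` both families of speeds satisfy `∂_j V^i = a_j (V^i - V^j) / b`. The ratios `∂_j V^i
/ (V^j - V^i)` thus agree, which is Tsarev's condition for diagonal flows to commute. The proof
compares the two mixed derivatives directly. -/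
theorem flowsCommute_tailSpeed (hI : ∀ i, IsOpen (I i)) (hF : IsParam I F) :
    FlowsCommute (dom I) speed (tailSpeed F) := by
  intro u ⟨hu, hD⟩ x i
  have hd := (contDiff_infty_iff_deriv.1 hu).2
  have hux : HasDerivAt u (deriv u x) x := ((contDiff_infty_iff_deriv.1 hu).1 x).hasDerivAt
  have hW := fun i => hasDerivAt_tailSpeed_comp hI hF hux (hD x) i
  have hV := fun i => hasDerivAt_speed_comp hux i
  have hvar : ∀ {A : Pt → Pt} {d : Pt}, HasDerivAt (flow A u) d x → ∀ ε : ℝ,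
      deriv (fun y => u y + ε • flow A u y) x = deriv u x + ε • d := fun h ε =>
    (hux.add (h.const_smul ε)).deriv
  have hline : ∀ q : Pt, HasDerivAt (fun ε : ℝ => u x + ε • q) q 0 := fun q => by
    simpa using ((hasDerivAt_id (0:ℝ)).smul_const q).const_add (u x)
  have hpt : ∀ q : Pt, u x + (0:ℝ) • q = u x := by simp
  obtain ⟨dW, hdW, hfW⟩ : ∃ d, d = _ ∧ HasDerivAt (flow (tailSpeed F) u) d x :=
    ⟨_, rfl, hasDerivAt_pi.2 fun i => (hW i).mul (hasDerivAt_component hd i x)⟩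
  obtain ⟨dV, hdV, hfV⟩ : ∃ d, d = _ ∧ HasDerivAt (flow speed u) d x :=
    ⟨_, rfl, hasDerivAt_pi.2 fun i => (hV i).mul (hasDerivAt_component hd i x)⟩
  have hl : ∀ d : Pt, HasDerivAt (fun ε : ℝ => (deriv u x + ε • d) i) (d i) 0 := fun d => by
    simpa using ((hasDerivAt_id (0:ℝ)).mul_const (d i)).const_add (deriv u x i)
  have r1 := (hasDerivAt_speed_comp (hline (flow (tailSpeed F) u x)) i).mul (hl dW)
  have r2 := (hasDerivAt_tailSpeed_comp hI hF (hline (flow speed u x))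
    (by rw [hpt]; exact hD x) i).mul (hl dV)
  refine ⟨_, (r1.congr_of_eventuallyEq (Eventually.of_forall fun ε => ?_)),
    ((r2.congr_of_eventuallyEq (Eventually.of_forall fun ε => ?_)).congr_deriv ?_)⟩
  · simp only [flow]
    rw [hvar hfW, Pi.mul_apply]
  · simp only [flow]
    rw [hvar hfV, Pi.mul_apply]
  · simp only [zero_smul, add_zero, hdV, hdW]
    fin_cases i <;>
    simp [flow, speed, tailSpeed_eq, trail, slope, Fin.sum_univ_three, b] <;> ring

/-! ### Gas dynamics -/

theorem gasEquations_iff {ρ c s : ℝ × ℝ → ℝ} {z : ℝ × ℝ} (hρ : DifferentiableAt ℝ ρ z)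
    (hc : DifferentiableAt ℝ c z) (hs : DifferentiableAt ℝ s z) (h0 : ρ z ≠ 0) :
    GasEquations ρ c s z ↔
      RiemannEquations ![fun y => -c y + s y - 1 / ρ y, fun y => -c y - s y + 1 / ρ y, s] z := by
  have e1 : fderiv ℝ (fun y => ρ y * c y) z = ρ z • fderiv ℝ c z + c z • fderiv ℝ ρ z :=
    fderiv_fun_mul hρ hc
  have hi : HasFDerivAt (fun y => 1 / ρ y) (-(ρ z ^ 2)⁻¹ • fderiv ℝ ρ z) z := by
    simp only [one_div]
    exact (hasDerivAt_inv h0).comp_hasFDerivAt z hρ.hasFDerivAt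
  have e2 := (hs.hasFDerivAt.sub hi).fderiv
  have e3 := ((hc.hasFDerivAt.neg.add hs.hasFDerivAt).sub hi).fderiv
  have e4 := ((hc.hasFDerivAt.neg.sub hs.hasFDerivAt).add hi).fderiv
  have e2' : fderiv ℝ (fun y => s y - 1 / ρ y) z = _ := e2
  have e3' : fderiv ℝ (fun y => -c y + s y - 1 / ρ y) z = _ := e3
  have e4' : fderiv ℝ (fun y => -c y - s y + 1 / ρ y) z = _ := e4
  unfold GasEquations RiemannEquations dt dx
  rw [Fin.forall_fin_succ, Fin.forall_fin_succ, Fin.forall_fin_succ]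
  simp only [e1, e2', e3', e4', speed, Matrix.cons_val_zero, Matrix.cons_val_succ,
    Matrix.cons_val_one, Matrix.cons_val, Fin.succ_zero_eq_one, Fin.succ_one_eq_two,
    add_apply, sub_apply, neg_apply, smul_apply, smul_eq_mul, IsEmpty.forall_iff, and_true]
  generalize fderiv ℝ ρ z (1, 0) = ρt
  generalize fderiv ℝ ρ z (0, 1) = ρx
  generalize fderiv ℝ c z (1, 0) = ct
  generalize fderiv ℝ c z (0, 1) = cx
  generalize fderiv ℝ s z (1, 0) = st
  generalize fderiv ℝ s z (0, 1) = sx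
  have hσ : ρ z * (1 / ρ z) = 1 := by field_simp
  have hq : (ρ z ^ 2)⁻¹ = (1 / ρ z) ^ 2 := by simp
  rw [hq]
  generalize 1 / ρ z = σ at *
  generalize ρ z = r at *
  generalize c z = c at *
  generalize s z = s at *
  constructor
  · rintro ⟨h1, h2, h3⟩
    refine ⟨?_, ?_, ?_⟩
    · linear_combination -h2 + h3 + σ ^ 2 * h1 - σ * cx * hσ
    · linear_combination -h2 - h3 - σ ^ 2 * h1 + σ * cx * hσ
    · linear_combination h3
  · rintro ⟨h1, h2, h3⟩
    refine ⟨?_, ?_, ?_⟩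
    -- Half the difference of the first two equations, less the third, is the equation for `-1/ρ`.
    -- The factor `ρ²` turns it into the one for `ρ`, and the other terms correct by `ρ · (1/ρ) =
    -- 1`.
    · linear_combination r ^ 2 * ((h1 - h2) / 2 - h3) + r ^ 2 * σ * cx * hσ
        - (r * σ + 1) * (ρt + r * cx + c * ρx) * hσ
    · linear_combination -(h1 + h2) / 2
    · linear_combination h3

end HydroType

namespace HydroType

variable {I : Fin 3 → Set ℝ} {F G : Fin 3 → ℝ → ℝ} {p : Pt}

/-! ### Calculus of partial derivatives -/

/-- `h` is differentiable at `p` with the partial derivatives `d k`. -/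
def HasPd (h : Pt → ℝ) (d : Pt) (p : Pt) : Prop :=
  HasFDerivAt h (∑ k, d k • ContinuousLinearMap.proj (R := ℝ) (φ := fun _ : Fin 3 => ℝ) k) p

namespace HasPd

variable {h g : Pt → ℝ} {d e : Pt}

theorem pd_eq (H : HasPd h d p) (k : Fin 3) : pd k h p = d k := by
  unfold pd
  rw [HasFDerivAt.fderiv H]
  simp [Fin.sum_univ_three]
  fin_cases k <;> simp

theorem congr (H : HasPd h d p) (hd : ∀ k, d k = e k) : HasPd h e p := by
  rwa [← show d = e from funext hd]

theorem congr_of_eventuallyEq (H : HasPd h d p) (hg : g =ᶠ[𝓝 p] h) : HasPd g d p :=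
  HasFDerivAt.congr_of_eventuallyEq H hg

theorem const (c : ℝ) : HasPd (fun _ => c) (fun _ => 0) p :=
  (hasFDerivAt_const c p).congr_fderiv (by simp)

theorem coord (i : Fin 3) : HasPd (fun q => q i) (fun k => if k = i then 1 else 0) p :=
  (ContinuousLinearMap.proj (R := ℝ) (φ := fun _ : Fin 3 => ℝ) i).hasFDerivAt.congr_fderiv
    (by ext v; simp)

theorem add (H : HasPd h d p) (H' : HasPd g e p) :
    HasPd (fun q => h q + g q) (fun k => d k + e k) p :=
  (HasFDerivAt.add H H').congr_fderiv (by simp [add_smul, Finset.sum_add_distrib])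

theorem mul (H : HasPd h d p) (H' : HasPd g e p) :
    HasPd (fun q => h q * g q) (fun k => d k * g p + h p * e k) p :=
  (HasFDerivAt.mul H H').congr_fderiv (by
    ext v
    simp only [add_apply, smul_apply, smul_eq_mul,
      ContinuousLinearMap.proj_apply, Fin.sum_univ_three]
    ring)

theorem const_mul (c : ℝ) (H : HasPd h d p) : HasPd (fun q => c * h q) (fun k => c * d k) p :=
  ((const c).mul H).congr fun k => by ring

theorem neg (H : HasPd h d p) : HasPd (fun q => -h q) (fun k => -d k) p := by
  simpa using H.const_mul (-1)

theorem sub (H : HasPd h d p) (H' : HasPd g e p) :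
    HasPd (fun q => h q - g q) (fun k => d k - e k) p := by
  simpa [sub_eq_add_neg] using H.add H'.neg

/-- The chain rule for a function of one variable. -/
theorem comp {φ : ℝ → ℝ} {φ' : ℝ} (hφ : HasDerivAt φ φ' (h p)) (H : HasPd h d p) :
    HasPd (fun q => φ (h q)) (fun k => φ' * d k) p :=
  (hφ.comp_hasFDerivAt p H).congr_fderiv (by
    rw [Finset.smul_sum]
    exact Finset.sum_congr rfl fun k _ => smul_smul _ _ _)

theorem comp_coord {φ : ℝ → ℝ} {φ' : ℝ} {i : Fin 3} (hφ : HasDerivAt φ φ' (p i)) :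
    HasPd (fun q => φ (q i)) (fun k => if k = i then φ' else 0) p :=
  (comp (h := fun q => q i) hφ (coord i)).congr fun k => by simp

theorem inv (H : HasPd h d p) (h0 : h p ≠ 0) :
    HasPd (fun q => (h q)⁻¹) (fun k => -(h p ^ 2)⁻¹ * d k) p :=
  comp (hasDerivAt_inv h0) H

theorem b : HasPd b slope p :=
  (((coord 2).const_mul 2).add (coord 1) |>.sub (coord 0)).congr fun k => by
    fin_cases k <;> simp [slope]

/-- The chain rule along a curve. -/
theorem comp_curve {γ : ℝ → Pt} {v : Pt} {t : ℝ} (H : HasPd h d (γ t)) (hγ : HasDerivAt γ v t) :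
    HasDerivAt (fun s => h (γ s)) (∑ k, d k * v k) t :=
  (HasFDerivAt.comp_hasDerivAt t H hγ).congr_deriv (by simp)

end HasPd

theorem pd_congr {h g : Pt → ℝ} (hg : h =ᶠ[𝓝 p] g) (k : Fin 3) : pd k h p = pd k g p := by
  unfold pd; rw [hg.fderiv_eq]

/-! ### Diagonal metrics -/

theorem inv_diagonal_of_ne_zero {d : Fin 3 → ℝ} (hd : ∀ k, d k ≠ 0) :
    (Matrix.diagonal d)⁻¹ = Matrix.diagonal fun k => (d k)⁻¹ :=
  Matrix.inv_eq_left_inv (by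
    rw [Matrix.diagonal_mul_diagonal, ← Matrix.diagonal_one]
    congr 1; funext k; exact inv_mul_cancel₀ (hd k))

theorem christoffel_diagonal {g : Pt → Matrix (Fin 3) (Fin 3) ℝ} {d : Fin 3 → Pt → ℝ}
    {e : Fin 3 → Pt} (hg : ∀ᶠ q in 𝓝 p, g q = Matrix.diagonal fun l => d l q)
    (hd : ∀ l, HasPd (d l) (e l) p) (h0 : ∀ l, d l p ≠ 0) (k i j : Fin 3) :
    christoffel g k i j p = (1 / 2) * ((d k p)⁻¹ * ((if k = j then e k i else 0)
      + (if k = i then e k j else 0) - if i = j then e i k else 0)) := by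
  have h1 : ∀ m l n, pd m (fun q => g q l n) p = if l = n then e l m else 0 := by
    intro m l n
    rw [pd_congr (g := fun q => (Matrix.diagonal fun l => d l q) l n)
      (hg.mono fun q hq => by rw [hq])]
    split_ifs with h
    · subst h
      simpa using (hd l).pd_eq m
    · simpa [Matrix.diagonal_apply_ne _ h] using (HasPd.const (p := p) 0).pd_eq m
  unfold christoffel
  simp only [h1, hg.self_of_nhds, inv_diagonal_of_ne_zero h0]
  rw [Finset.sum_eq_single k (fun l _ hl => by simp [Matrix.diagonal_apply_ne _ hl.symm])
    (fun h => absurd (Finset.mem_univ k) h)]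
  simp

theorem IsNondegParam.hasPd (hI : ∀ i, IsOpen (I i)) (hF : IsNondegParam I F) (hp : p ∈ dom I)
    (i : Fin 3) :
    HasPd (fun q => F i (q i)) (fun k => if k = i then deriv (F i) (p i) else 0) p :=
  HasPd.comp_coord (hF.1.hasDerivAt hI (hp.1 i))

theorem IsNondegParam.hasPd_deriv (hI : ∀ i, IsOpen (I i)) (hF : IsNondegParam I F)
    (hp : p ∈ dom I) (i : Fin 3) : HasPd (fun q => deriv (F i) (q i))
      (fun k => if k = i then deriv (deriv (F i)) (p i) else 0) p :=
  HasPd.comp_coord (φ := deriv (F i))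
    ((hF.1.contDiffAt_deriv hI (hp.1 i)).differentiableAt (by simp)).hasDerivAt

theorem IsNondegParam.ne_zero (hF : IsNondegParam I F) (hp : p ∈ dom I) (i : Fin 3) :
    F i (p i) ≠ 0 := hF.2 i _ (hp.1 i)

/-! ### The connection of the metric -/

/-- The Christoffel symbols of `gasMetric F` in closed form. -/
noncomputable def gasChristoffel (F : Fin 3 → ℝ → ℝ) (k i j : Fin 3) (p : Pt) : ℝ :=
  -((if k = j then slope i else 0) + (if k = i then slope j else 0)) * (b p)⁻¹
    + (if i = j then slope k else 0) * (F k (p k) * ((F i (p i))⁻¹ * (b p)⁻¹))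
    - (if i = j ∧ i = k then 1 / 2 else 0) * (deriv (F i) (p i) * (F i (p i))⁻¹)

theorem christoffel_gasMetric (hI : ∀ i, IsOpen (I i)) (hF : IsNondegParam I F) (hp : p ∈ dom I)
    (k i j : Fin 3) : christoffel (gasMetric F) k i j p = gasChristoffel F k i j p := by
  have hb : b p ≠ 0 := hp.2
  have hn := hF.ne_zero hp
  have hd : ∀ l, HasPd (fun q => (b q ^ 2)⁻¹ * (F l (q l))⁻¹) _ p := fun l =>
    ((HasPd.comp (hasDerivAt_pow 2 (b p)) HasPd.b).inv (pow_ne_zero 2 hb)).mul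
      ((hF.hasPd hI hp l).inv (hn l))
  rw [christoffel_diagonal (g := gasMetric F) (Eventually.of_forall fun q => rfl) hd
    fun l => mul_ne_zero (inv_ne_zero (pow_ne_zero 2 hb)) (inv_ne_zero (hn l))]
  have h0 := hn 0
  have h1 := hn 1
  have h2 := hn 2
  unfold gasChristoffel
  fin_cases k <;> fin_cases i <;> fin_cases j <;> simp <;> field_simp <;> ring

theorem isGeneratedBy_gasMetric (hI : ∀ i, IsOpen (I i)) (hF : IsNondegParam I F) :
    (gasOp F).IsGeneratedBy (gasMetric F) (dom I) := by
  intro p hp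
  have hb : b p ≠ 0 := hp.2
  have hn := hF.ne_zero hp
  have hg : ∀ i, (b p ^ 2)⁻¹ * (F i (p i))⁻¹ ≠ 0 := fun i =>
    mul_ne_zero (inv_ne_zero (pow_ne_zero 2 hb)) (inv_ne_zero (hn i))
  have hinv : (gasMetric F p)⁻¹ = Matrix.diagonal fun i => b p ^ 2 * F i (p i) := by
    unfold gasMetric
    rw [inv_diagonal_of_ne_zero hg]
    simp [mul_comm]
  refine ⟨?_, Matrix.isSymm_diagonal _, hinv.symm, fun X i j => ?_⟩
  · unfold gasMetric
    rw [Matrix.det_diagonal, isUnit_iff_ne_zero]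
    exact Finset.prod_ne_zero_iff.2 fun i _ => hg i
  · rw [hinv, Finset.sum_eq_single i (fun s _ hs => by simp [Matrix.diagonal_apply_ne _ hs.symm])
      (fun h => absurd (Finset.mem_univ i) h)]
    simp only [christoffel_gasMetric hI hF hp, Matrix.diagonal_apply_eq, Fin.sum_univ_three,
      gasChristoffel]
    have h0 := hn 0
    have h1 := hn 1
    have h2 := hn 2
    fin_cases i <;> fin_cases j <;> simp [gasOp, slope] <;> field_simp <;> ring

/-! ### Conformal flatness -/

/-- Multiplication by `b²` leaves `∑ (du^i)² / F_i(u^i)`, a product of one-dimensional metrics. Its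
only Christoffel symbols are `Γ^i_{ii}`, functions of `u^i` alone. -/
theorem isConformallyFlatOn_gasMetric (hI : ∀ i, IsOpen (I i)) (hF : IsNondegParam I F) :
    IsConformallyFlatOn (gasMetric F) (dom I) := by
  intro p hp
  refine ⟨dom I, isOpen_dom hI, hp, subset_rfl, fun q => b q ^ 2, (contDiff_b.pow 2).contDiffOn,
    fun q hq => by have := hq.2; positivity, ?_⟩
  have hΓ : ∀ q ∈ dom I, ∀ k i j, christoffel (fun q => b q ^ 2 • gasMetric F q) k i j q
      = (if i = j ∧ i = k then -(1 / 2) else 0) * (deriv (F i) (q i) * (F i (q i))⁻¹) := by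
    intro q hq k i j
    have hn := hF.ne_zero hq
    rw [christoffel_diagonal (d := fun l q => (F l (q l))⁻¹)
      (e := fun l k => -(F l (q l) ^ 2)⁻¹ * if k = l then deriv (F l) (q l) else 0) ?_
      (fun l => (hF.hasPd hI hq l).inv (hn l)) fun l => inv_ne_zero (hn l)]
    · have h0 := hn 0
      have h1 := hn 1
      have h2 := hn 2
      fin_cases k <;> fin_cases i <;> fin_cases j <;> simp <;> field_simp
    · filter_upwards [(isOpen_dom hI).mem_nhds hq] with r hr
      have hb : b r ≠ 0 := hr.2
      unfold gasMetric
      rw [← Matrix.diagonal_smul]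
      congr 1
      funext l
      simp only [Pi.smul_apply, smul_eq_mul]
      field_simp
  intro q hq i j k l
  have hn := hF.ne_zero hq
  have hpd : ∀ m k i j, pd m (christoffel (fun q => b q ^ 2 • gasMetric F q) k i j) q
      = (if i = j ∧ i = k then -(1 / 2) else 0)
        * ((if m = i then deriv (deriv (F i)) (q i) else 0) * (F i (q i))⁻¹
          + deriv (F i) (q i) * (-(F i (q i) ^ 2)⁻¹ * if m = i then deriv (F i) (q i) else 0)) :=
    fun m k i j => by
      rw [pd_congr (g := fun q => (if i = j ∧ i = k then -(1 / 2) else 0)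
        * (deriv (F i) (q i) * (F i (q i))⁻¹))
        (eventually_of_mem ((isOpen_dom hI).mem_nhds hq) fun r hr => hΓ r hr k i j)]
      exact (((hF.hasPd_deriv hI hq i).mul ((hF.hasPd hI hq i).inv (hn i))).const_mul _).pd_eq m
  unfold riemann
  simp only [hpd, hΓ q hq, Fin.sum_univ_three]
  fin_cases i <;> fin_cases j <;> fin_cases k <;> fin_cases l <;> simp

/-! ### Curvature -/

-- For `b⁻²` times a flat metric whose Hessian of `b` is diagonal, the sectional curvatures are `b
-- (Hess_ii + Hess_jj) - |∇b|²` in an orthonormal frame. Here `Hess_ii = a_i F_i' / 2` and `|∇b|² =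
-- 2 S`, so they equal `w^i + w^j`. The proof checks all components from the Christoffel symbols.
set_option maxHeartbeats 4000000 in
theorem riemann_gasMetric (hI : ∀ i, IsOpen (I i)) (hF : IsNondegParam I F) (hp : p ∈ dom I)
    (i j k l : Fin 3) :
    riemann (gasMetric F) i j k l p = (tailSpeed F p i + tailSpeed F p j)
      * ((b p ^ 2)⁻¹ * (F j (p j))⁻¹)
      * ((if i = k ∧ j = l then 1 else 0) - if i = l ∧ j = k then 1 else 0) := by
  have hb : b p ≠ 0 := hp.2
  have hn := hF.ne_zero hp
  have h0 := hn 0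
  have h1 := hn 1
  have h2 := hn 2
  have hbi : HasPd (fun q => (b q)⁻¹) _ p := HasPd.b.inv hb
  have hpd : ∀ m k i j, pd m (christoffel (gasMetric F) k i j) p =
      -((if k = j then slope i else 0) + (if k = i then slope j else 0))
          * (-(b p ^ 2)⁻¹ * slope m)
        + (if i = j then slope k else 0) * ((if m = k then deriv (F k) (p k) else 0)
            * ((F i (p i))⁻¹ * (b p)⁻¹)
          + F k (p k) * ((-(F i (p i) ^ 2)⁻¹ * if m = i then deriv (F i) (p i) else 0) * (b p)⁻¹
            + (F i (p i))⁻¹ * (-(b p ^ 2)⁻¹ * slope m)))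
        - (if i = j ∧ i = k then 1 / 2 else 0)
          * ((if m = i then deriv (deriv (F i)) (p i) else 0) * (F i (p i))⁻¹
          + deriv (F i) (p i) * (-(F i (p i) ^ 2)⁻¹ * if m = i then deriv (F i) (p i) else 0)) :=
      fun m k i j => by
    rw [pd_congr (g := gasChristoffel F k i j) (eventually_of_mem ((isOpen_dom hI).mem_nhds hp)
      fun r hr => christoffel_gasMetric hI hF hr k i j)]
    exact (((hbi.const_mul _).add (((hF.hasPd hI hp k).mul
      (((hF.hasPd hI hp i).inv (hn i)).mul hbi)).const_mul _)).sub
      (((hF.hasPd_deriv hI hp i).mul ((hF.hasPd hI hp i).inv (hn i))).const_mul _)).pd_eq m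
  unfold riemann
  simp only [hpd, christoffel_gasMetric hI hF hp, gasChristoffel, tailSpeed_eq, trail,
    Fin.sum_univ_three]
  fin_cases i <;> fin_cases j <;> fin_cases k <;> fin_cases l <;> simp [slope] <;> field_simp <;> ring

end HydroType

namespace HydroType

variable {I : Fin 3 → Set ℝ} {F G : Fin 3 → ℝ → ℝ} {p : Pt}

/-! ### Criterion of flatness -/

theorem exists_affine_of_deriv_eq {s : Set ℝ} (hs : IsOpen s) (hc : s.OrdConnected) {f : ℝ → ℝ}
    (hf : ∀ x ∈ s, DifferentiableAt ℝ f x) {e : ℝ} (he : ∀ x ∈ s, deriv f x = e) :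
    ∃ c, ∀ x ∈ s, f x = e * x + c := by
  rcases s.eq_empty_or_nonempty with rfl | ⟨y, hy⟩
  · exact ⟨0, fun x hx => hx.elim⟩
  have hd : ∀ x ∈ s, HasDerivAt (fun x => f x - e * x) (deriv f x - e * 1) x := fun x hx =>
    (hf x hx).hasDerivAt.sub ((hasDerivAt_id x).const_mul e)
  refine ⟨f y - e * y, fun x hx => ?_⟩
  have h : f x - e * x = f y - e * y := hs.is_const_of_deriv_eq_zero hc.isPreconnected
    (fun x hx => (hd x hx).differentiableAt.differentiableWithinAt)
    (fun x hx => by simp [(hd x hx).deriv, he x hx]) hx hy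
  linarith

theorem IsFlatParam.tailSpeed_eq_zero (hI : ∀ i, IsOpen (I i)) (hF : IsFlatParam I F)
    (hp : p ∈ dom I) : tailSpeed F p = 0 := by
  obtain ⟨ε, α, β, γ, h0, hf, hφ, hψ⟩ := hF
  have hd : ∀ {i : Fin 3} {e c : ℝ}, (∀ s ∈ I i, F i s = e * s + c) → deriv (F i) (p i) = e :=
    fun {i e c} h => by
      have h1 : HasDerivAt (fun s : ℝ => e * s + c) e (p i) := by
        simpa using ((hasDerivAt_id (p i)).const_mul e).add_const c
      exact (h1.congr_of_eventuallyEq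
        (eventually_of_mem ((hI i).mem_nhds (hp.1 i)) h)).deriv
  have e0 := hf _ (hp.1 0)
  have e1 := hφ _ (hp.1 1)
  have e2 := hψ _ (hp.1 2)
  funext i
  simp only [tailSpeed_eq, trail, Fin.sum_univ_three, e0, e1, e2, Pi.zero_apply]
  fin_cases i
  · simp [hd hf, slope, b]; linarith
  · simp [hd hφ, slope, b]; linarith
  · simp [hd hψ, slope, b]; linarith

/-- In `w^i - w^j` the sum `S` drops out, leaving `b (a_i F_i'(u^i) - a_j F_j'(u^j)) / 2`. The
variables are independent, so all `a_i F_i'` equal one constant. One equation `w^i = 0` then gives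
the relation between `α`, `β` and `γ`. -/
theorem isFlatParam_of_tailSpeed_eq_zero (hI : ∀ i, IsOpen (I i)) (hc : ∀ i, (I i).OrdConnected)
    (hne : ∀ i, (I i).Nonempty) (hF : IsParam I F) (h : ∀ p ∈ dom I, tailSpeed F p = 0) :
    IsFlatParam I F := by
  -- the differences of the speeds give relations between the derivatives
  have key : ∀ {i j : Fin 3}, i ≠ j → ∀ s ∈ I i, ∀ t ∈ I j,
      slope i * deriv (F i) s = slope j * deriv (F j) t := by
    intro i j hij s hs t ht
    obtain ⟨p, hp, rfl, rfl⟩ := exists_mem_dom_pair hI hne hij hs ht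
    have hi := congrFun (h p hp) i
    have hj := congrFun (h p hp) j
    rw [tailSpeed_eq, Pi.zero_apply] at hi hj
    have hb : b p ≠ 0 := hp.2
    refine mul_left_cancel₀ (div_ne_zero hb two_ne_zero) ?_
    linarith
  obtain ⟨t, ht⟩ := hne 1
  obtain ⟨s, hs⟩ := hne 0
  have hdiff : ∀ i, ∀ x ∈ I i, DifferentiableAt ℝ (F i) x := fun i x hx =>
    (hF.hasDerivAt hI hx).differentiableAt
  obtain ⟨α, hα⟩ := exists_affine_of_deriv_eq (hI 0) (hc 0) (hdiff 0) (e := -deriv (F 1) t)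
    fun x hx => by
      have := key (show (0 : Fin 3) ≠ 1 by decide) x hx t ht
      simp [slope] at this; linarith
  obtain ⟨β, hβ⟩ := exists_affine_of_deriv_eq (hI 1) (hc 1) (hdiff 1) (e := -(-deriv (F 1) t))
    fun x hx => by
      have h1 := key (show (0 : Fin 3) ≠ 1 by decide) s hs x hx
      have h2 := key (show (0 : Fin 3) ≠ 1 by decide) s hs t ht
      simp [slope] at h1 h2; linarith
  obtain ⟨γ, hγ⟩ := exists_affine_of_deriv_eq (hI 2) (hc 2) (hdiff 2)
    (e := -((-deriv (F 1) t) / 2)) fun x hx => by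
      have := key (show (2 : Fin 3) ≠ 1 by decide) x hx t ht
      simp [slope] at this; linarith
  refine ⟨-deriv (F 1) t, α, β, γ, ?_, hα, hβ, hγ⟩
  obtain ⟨p, hp, rfl⟩ := exists_mem_dom hI hne ht
  have h1 := congrFun (h p hp) 1
  rw [tailSpeed_eq, trail, Fin.sum_univ_three, hα _ (hp.1 0), hβ _ (hp.1 1), hγ _ (hp.1 2)] at h1
  simp [slope, b] at h1
  linarith

theorem isFlatOn_gasMetric_iff (hI : ∀ i, IsOpen (I i)) (hc : ∀ i, (I i).OrdConnected)
    (hne : ∀ i, (I i).Nonempty) (hF : IsNondegParam I F) :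
    IsFlatOn (gasMetric F) (dom I) ↔ IsFlatParam I F := by
  constructor
  · refine fun h => isFlatParam_of_tailSpeed_eq_zero hI hc hne hF.1 fun p hp => ?_
    -- The three pairwise sums of the numbers `w^i` vanish, hence so do the numbers.
    have key : ∀ {i j : Fin 3}, i ≠ j → tailSpeed F p i + tailSpeed F p j = 0 := by
      intro i j hij
      have h1 := h p hp i j i j
      rw [riemann_gasMetric hI hF hp] at h1
      have hb : b p ≠ 0 := hp.2
      simpa [hij, hb, hF.ne_zero hp j] using h1
    have h01 := key (show (0 : Fin 3) ≠ 1 by decide)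
    have h02 := key (show (0 : Fin 3) ≠ 2 by decide)
    have h12 := key (show (1 : Fin 3) ≠ 2 by decide)
    funext i
    rw [Pi.zero_apply]
    fin_cases i <;> simp only [Fin.zero_eta, Fin.mk_one, Fin.reduceFinMk] <;> linarith
  · intro h p hp i j k l
    rw [riemann_gasMetric hI hF hp, h.tailSpeed_eq_zero hI hp]
    simp

/-! ### The system as a Hamiltonian system -/

/-- `f α'' + f' α' / 2 = 2`, for `α = ± (∫ ds/√|f|)²` and its derivatives. -/
structure IsProfile (s : Set ℝ) (f α α₁ α₂ : ℝ → ℝ) : Prop where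
  smooth : ContDiffOn ℝ ∞ α s
  hasDerivAt : ∀ x ∈ s, HasDerivAt α (α₁ x) x
  hasDerivAt' : ∀ x ∈ s, HasDerivAt α₁ (α₂ x) x
  eq_two : ∀ x ∈ s, f x * α₂ x + (1 / 2) * deriv f x * α₁ x = 2

theorem IsProfile.smooth' {s : Set ℝ} {f α α₁ α₂ : ℝ → ℝ} (h : IsProfile s f α α₁ α₂)
    (hs : IsOpen s) : ContDiffOn ℝ ∞ α₁ s :=
  ((contDiffOn_infty_iff_deriv_of_isOpen hs).1 h.smooth).2.congr fun x hx =>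
    (h.hasDerivAt x hx).deriv.symm

variable {α α₁ α₂ β β₁ β₂ : ℝ → ℝ} {h : Pt → ℝ}

/-- The potential of the second nonlocal term on the gradient of the density. -/
noncomputable def tailPotential (F : Fin 3 → ℝ → ℝ) (α₁ β₁ : ℝ → ℝ) (h : Pt → ℝ) (p : Pt) : ℝ :=
  (1 / 2) * (p 0 + p 1) - trail F p * h p
    - (1 / 4) * (F 0 (p 0) * α₁ (p 0) + F 1 (p 1) * β₁ (p 1))

/-- The left side is `∂_k (b h)`, and `b h = (α - β) / 4` has separated variables. This is the
transformed covector of `∇h` when `K = h`. -/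
theorem hasPd_density (hI : ∀ i, IsOpen (I i)) (hα : IsProfile (I 0) (F 0) α α₁ α₂)
    (hβ : IsProfile (I 1) (F 1) β β₁ β₂)
    (hh : ∀ q ∈ dom I, h q = (1 / 4) * ((α (q 0) - β (q 1)) * (b q)⁻¹)) (hp : p ∈ dom I) :
    ∃ d : Pt, HasPd h d p ∧ ∀ k, b p * d k + slope k * h p
      = (if k = 0 then (1 / 4) * α₁ (p 0) else 0) - if k = 1 then (1 / 4) * β₁ (p 1) else 0 := by
  have hb : b p ≠ 0 := hp.2
  refine ⟨_, (((((HasPd.comp_coord (hα.hasDerivAt _ (hp.1 0))).sub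
    (HasPd.comp_coord (hβ.hasDerivAt _ (hp.1 1)))).mul (HasPd.b.inv hb)).const_mul
      (1 / 4)).congr_of_eventuallyEq (eventually_of_mem ((isOpen_dom hI).mem_nhds hp) hh)), ?_⟩
  intro k
  rw [hh p hp]
  split_ifs <;> field_simp <;> ring

theorem contDiffOn_comp_coord {s : ℝ → ℝ} {i : Fin 3} (hs : ContDiffOn ℝ ∞ s (I i)) :
    ContDiffOn ℝ ∞ (fun q : Pt => s (q i)) (dom I) :=
  hs.comp (contDiff_apply ℝ ℝ i).contDiffOn fun _ hq => hq.1 i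

theorem contDiffOn_density (hα : IsProfile (I 0) (F 0) α α₁ α₂)
    (hβ : IsProfile (I 1) (F 1) β β₁ β₂)
    (hh : ∀ q ∈ dom I, h q = (1 / 4) * ((α (q 0) - β (q 1)) * (b q)⁻¹)) :
    ContDiffOn ℝ ∞ h (dom I) :=
  (contDiffOn_const.mul (((contDiffOn_comp_coord hα.smooth).sub
    (contDiffOn_comp_coord hβ.smooth)).mul
      (contDiff_b.contDiffOn.inv fun _ hq => hq.2))).congr hh

theorem contDiffOn_tailPotential (hI : ∀ i, IsOpen (I i)) (hF : IsParam I F)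
    (hα : IsProfile (I 0) (F 0) α α₁ α₂) (hβ : IsProfile (I 1) (F 1) β β₁ β₂)
    (hh : ∀ q ∈ dom I, h q = (1 / 4) * ((α (q 0) - β (q 1)) * (b q)⁻¹)) :
    ContDiffOn ℝ ∞ (tailPotential F α₁ β₁ h) (dom I) := by
  have hc := fun i => contDiffOn_comp_coord (hF i)
  unfold tailPotential trail
  exact ((ContDiff.contDiffOn (by fun_prop)).sub ((contDiffOn_const.mul (ContDiffOn.sum fun i _ =>
    contDiffOn_const.mul (hc i))).mul (contDiffOn_density hα hβ hh))).sub
    (contDiffOn_const.mul (((hc 0).mul (contDiffOn_comp_coord (hα.smooth' (hI 0)))).add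
      ((hc 1).mul (contDiffOn_comp_coord (hβ.smooth' (hI 1))))))

/-- Using `b h_k + a_k h = ∂_k (b h)`, one gets `w^k h_k = -∂_k (S h) + a_k F_k' ∂_k (b h) / 2`. By
the profile equations the last term is the derivative of the remaining part of the potential. -/
theorem pd_tailPotential (hI : ∀ i, IsOpen (I i)) (hF : IsParam I F)
    (hα : IsProfile (I 0) (F 0) α α₁ α₂) (hβ : IsProfile (I 1) (F 1) β β₁ β₂)
    (hh : ∀ q ∈ dom I, h q = (1 / 4) * ((α (q 0) - β (q 1)) * (b q)⁻¹)) (hp : p ∈ dom I)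
    (k : Fin 3) : pd k (tailPotential F α₁ β₁ h) p = tailSpeed F p k * pd k h p := by
  obtain ⟨d, hd, hn⟩ := hasPd_density hI hα hβ hh hp
  have hf := fun i : Fin 3 => HasPd.comp_coord (hF.hasDerivAt hI (hp.1 i))
  have hS : HasPd (trail F) _ p :=
    (((((hf 0).const_mul (slope 0 ^ 2)).add ((hf 1).const_mul (slope 1 ^ 2))).add
      ((hf 2).const_mul (slope 2 ^ 2))).const_mul (1 / 2)).congr_of_eventuallyEq
      (Eventually.of_forall fun q => by simp only [trail, Fin.sum_univ_three])
  have hq : HasPd (tailPotential F α₁ β₁ h) _ p :=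
    (((((HasPd.coord 0).add (HasPd.coord 1)).const_mul (1 / 2)).sub (hS.mul hd)).sub
      ((((hf 0).mul (HasPd.comp_coord (hα.hasDerivAt' _ (hp.1 0)))).add
        ((hf 1).mul (HasPd.comp_coord (hβ.hasDerivAt' _ (hp.1 1))))).const_mul (1 / 4)))
  have e0 := hα.eq_two _ (hp.1 0)
  have e1 := hβ.eq_two _ (hp.1 1)
  have hk := hn k
  rw [hq.pd_eq, hd.pd_eq, tailSpeed_eq]
  fin_cases k <;> simp [slope] at hk ⊢
  · linear_combination (1 / 2) * deriv (F 0) (p 0) * hk - (1 / 4) * e0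
  · linear_combination (-1 / 2) * deriv (F 1) (p 1) * hk - (1 / 4) * e1
  · linear_combination -deriv (F 2) (p 2) * hk

/-- On `∇h` the scalar operators give `u_x / 2`, `-v_x / 2` and `0` by the profile equations, and
the coefficient of `u^i_x` collapses to `(u + v) / 2`. The speeds are therefore `(u + v) / 2` plus
`b/2`, `-b/2` and `0`. -/
theorem flow_speed_eq_act (hI : ∀ i, IsOpen (I i)) (hα : IsProfile (I 0) (F 0) α α₁ α₂)
    (hβ : IsProfile (I 1) (F 1) β β₁ β₂)
    (hh : ∀ q ∈ dom I, h q = (1 / 4) * ((α (q 0) - β (q 1)) * (b q)⁻¹)) {u : ℝ → Pt}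
    (hu : IsField (dom I) u) (x : ℝ) (K : Fin 2 → ℝ → ℝ) (hK0 : K 0 x = h (u x))
    (hK1 : K 1 x = tailPotential F α₁ β₁ h (u x)) :
    flow speed u x = (gasOp F).act u (fun y k => pd k h (u y)) K x := by
  obtain ⟨hu, hD⟩ := hu
  let n : Pt → Pt := fun p k =>
    (if k = 0 then (1 / 4) * α₁ (p 0) else 0) - if k = 1 then (1 / 4) * β₁ (p 1) else 0
  have e1 : ∀ y k, b (u y) * pd k h (u y) + slope k * h (u y) = n (u y) k := fun y k => by
    obtain ⟨d, hd, hn⟩ := hasPd_density hI hα hβ hh (hD y)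
    rw [hd.pd_eq]; exact hn k
  have hux : HasDerivAt u (deriv u x) x := ((contDiff_infty_iff_deriv.1 hu).1 x).hasDerivAt
  have hhx : HasDerivAt (fun y => h (u y)) (∑ k, deriv u x k * pd k h (u x)) x := by
    obtain ⟨d, hd, -⟩ := hasPd_density hI hα hβ hh (hD x)
    exact (hd.comp_curve hux).congr_deriv (Finset.sum_congr rfl fun k _ => by
      rw [hd.pd_eq, mul_comm])
  have hnx : ∀ k, HasDerivAt (fun y => n (u y) k)
      ((if k = 0 then (1 / 4) * (α₂ (u x 0) * deriv u x 0) else 0)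
        - if k = 1 then (1 / 4) * (β₂ (u x 1) * deriv u x 1) else 0) x := by
    intro k
    have h0 := ((hα.hasDerivAt' _ ((hD x).1 0)).comp x (hasDerivAt_component hu 0 x)).const_mul
      (1 / 4)
    have h1 := ((hβ.hasDerivAt' _ ((hD x).1 1)).comp x (hasDerivAt_component hu 1 x)).const_mul
      (1 / 4)
    refine HasDerivAt.sub ?_ ?_
    · split_ifs
      · exact h0
      · exact hasDerivAt_const x 0
    · split_ifs
      · exact h1
      · exact hasDerivAt_const x 0
  have hξ : ∀ k, DifferentiableAt ℝ (fun y => pd k h (u y)) x := by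
    intro k
    have hq : DifferentiableAt ℝ (fun y => (n (u y) k - slope k * h (u y)) / b (u y)) x :=
      (((hnx k).sub (hhx.const_mul _)).div (hasDerivAt_b hu x) (hD x).2).differentiableAt
    refine hq.congr_of_eventuallyEq (Eventually.of_forall fun y => ?_)
    have hb : b (u y) ≠ 0 := (hD y).2
    change _ = (n (u y) k - slope k * h (u y)) / b (u y)
    rw [eq_div_iff hb, ← e1]
    ring
  have hξ' : HasDerivAt (fun y k => pd k h (u y)) (fun k => deriv (fun y => pd k h (u y)) x) x :=
    hasDerivAt_pi.2 fun k => (hξ k).hasDerivAt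
  have e2 : ∀ k, b (deriv u x) * pd k h (u x) + b (u x) * deriv (fun y => pd k h (u y)) x
      + slope k * ∑ j, deriv u x j * pd j h (u x) = _ := fun k =>
    ((((hasDerivAt_b hu x).mul (hξ k).hasDerivAt).add (hhx.const_mul (slope k))).congr_of_eventuallyEq
      (Eventually.of_forall fun y => (e1 y k).symm)).unique (hnx k)
  have a0 := hα.eq_two _ ((hD x).1 0)
  have a1 := hβ.eq_two _ ((hD x).1 1)
  funext i
  rw [act_gasOp, hξ'.deriv, hK0, hK1]
  simp only [e1, e2, tailPotential, flow]
  fin_cases i <;> simp [n, slope, Fin.sum_univ_three, speed, b]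
  · linear_combination -(1 / 4) * (2 * u x 2 + u x 1 - u x 0) * deriv u x 0 * a0
  · linear_combination (1 / 4) * (2 * u x 2 + u x 1 - u x 0) * deriv u x 1 * a1
  · ring

theorem isHamiltonianSystem_gasOp (hI : ∀ i, IsOpen (I i)) (hF : IsParam I F)
    (hα : IsProfile (I 0) (F 0) α α₁ α₂) (hβ : IsProfile (I 1) (F 1) β β₁ β₂)
    (hh : ∀ q ∈ dom I, h q = (1 / 4) * ((α (q 0) - β (q 1)) * (b q)⁻¹)) :
    IsHamiltonianSystem (dom I) speed (gasOp F) h := by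
  have hs := contDiffOn_density hα hβ hh
  refine ⟨hs, (![h, tailPotential F α₁ β₁ h] : Fin 2 → Pt → ℝ), ?_, fun u hu x => ?_⟩
  · have : ∀ m : Fin 2, ContDiffOn ℝ ∞ ((![h, tailPotential F α₁ β₁ h] : Fin 2 → Pt → ℝ) m) (dom I)
        ∧ ∀ p ∈ dom I, ∀ k, pd k ((![h, tailPotential F α₁ β₁ h] : Fin 2 → Pt → ℝ) m) p
          = (![fun _ _ => 1, tailSpeed F] : Fin 2 → Pt → Pt) m p k * pd k h p :=
      Fin.forall_fin_two.2 ⟨⟨hs, fun p _ k => (one_mul _).symm⟩,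
        contDiffOn_tailPotential hI hF hα hβ hh, fun p hp k => pd_tailPotential hI hF hα hβ hh hp k⟩
    exact this
  · exact flow_speed_eq_act hI hα hβ hh hu x _ rfl rfl

theorem act_gasOp_eq_localPart (F : Fin 3 → ℝ → ℝ) (u ξ : ℝ → Pt) (K : Fin 2 → ℝ → ℝ)
    (K' : Fin 0 → ℝ → ℝ) (x : ℝ) (i : Fin 3) :
    (gasOp F).act u ξ K x i = (gasOp F).localPart.act u ξ K' x i
      + (tailSpeed F (u x) i * deriv u x i * K 0 x + deriv u x i * K 1 x) := by
  have hz : ∀ g : Fin (gasOp F).localPart.N → ℝ, ∑ m, g m = 0 := fun g =>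
    Finset.sum_eq_zero fun m _ => Fin.elim0 m
  have h2 : ∀ g : Fin (gasOp F).N → ℝ, ∑ m, g m = g (0 : Fin 2) + g (1 : Fin 2) :=
    Fin.sum_univ_two
  unfold HydroOp.act
  rw [hz, h2, add_zero]
  simp [gasOp, HydroOp.localPart]

/-- When `w = 0`, the first nonlocal term has a zero coefficient, but the second still contributes
`u^i_x` times its potential. The density must be normalised so that this constant is zero. -/
theorem isHamiltonianSystem_localPart (hI : ∀ i, IsOpen (I i))
    (hα : IsProfile (I 0) (F 0) α α₁ α₂) (hβ : IsProfile (I 1) (F 1) β β₁ β₂)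
    (hh : ∀ q ∈ dom I, h q = (1 / 4) * ((α (q 0) - β (q 1)) * (b q)⁻¹))
    (hw : ∀ p ∈ dom I, tailSpeed F p = 0) (hq : ∀ p ∈ dom I, tailPotential F α₁ β₁ h p = 0) :
    IsHamiltonianSystem (dom I) speed (gasOp F).localPart h := by
  refine ⟨contDiffOn_density hα hβ hh, fun _ _ => 0, fun m => Fin.elim0 m, fun u hu x => ?_⟩
  rw [flow_speed_eq_act hI hα hβ hh hu x (![fun y => h (u y), fun _ => 0] : Fin 2 → ℝ → ℝ) rfl
    (hq _ (hu.2 x)).symm]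
  funext i
  rw [act_gasOp_eq_localPart F u _ _ (fun m => Fin.elim0 m)]
  simp [hw _ (hu.2 x)]
  rfl

end HydroType

namespace HydroType

variable {I : Fin 3 → Set ℝ} {F G : Fin 3 → ℝ → ℝ} {p : Pt}

/-! ### The densities -/

theorem exists_sign {s : Set ℝ} (hc : s.OrdConnected) {f : ℝ → ℝ} (hf : ContinuousOn f s)
    (h0 : ∀ x ∈ s, f x ≠ 0) : ∃ σ : ℝ, σ ^ 2 = 1 ∧ ∀ x ∈ s, Real.sign (f x) = σ ∧ |f x| = σ * f x := by
  by_cases h : ∃ y ∈ s, 0 < f y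
  · obtain ⟨y, hy, hpos⟩ := h
    refine ⟨1, by norm_num, fun x hx => ?_⟩
    have : 0 < f x := by
      by_contra hn
      obtain ⟨z, hz, hz0⟩ := hc.isPreconnected.intermediate_value hx hy hf
        (⟨not_lt.1 hn, hpos.le⟩ : (0:ℝ) ∈ Set.Icc (f x) (f y))
      exact h0 z hz hz0
    rw [Real.sign_of_pos this, abs_of_pos this, one_mul]
    exact ⟨rfl, rfl⟩
  · refine ⟨-1, by norm_num, fun x hx => ?_⟩
    have : f x < 0 := lt_of_le_of_ne (not_lt.1 fun h' => h ⟨x, hx, h'⟩) (h0 x hx)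
    rw [Real.sign_of_neg this, abs_of_neg this, neg_one_mul]
    exact ⟨rfl, rfl⟩

/-- The equation says `σ (√|f| d/dx)² α = 2`. Since `√|f| A' = 1`, the operator `√|f| d/dx` acts as
`d/dA`, and `(d/dA)² A² = 2`. -/
theorem isProfile_sq {s : Set ℝ} (hs : IsOpen s) {f A : ℝ → ℝ} {σ : ℝ} (hσ : σ ^ 2 = 1)
    (hf : ContDiffOn ℝ ∞ f s) (h0 : ∀ x ∈ s, f x ≠ 0) (habs : ∀ x ∈ s, |f x| = σ * f x)
    (hA : ∀ x ∈ s, HasDerivAt A (1 / √|f x|) x) :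
    ∃ α₁ α₂, IsProfile s f (fun x => σ * A x ^ 2) α₁ α₂ := by
  have hpos : ∀ x ∈ s, 0 < σ * f x := fun x hx => habs x hx ▸ abs_pos.2 (h0 x hx)
  have hA' : ∀ x ∈ s, HasDerivAt A (1 / √(σ * f x)) x := fun x hx => habs x hx ▸ hA x hx
  have hd : ∀ x ∈ s, HasDerivAt f (deriv f x) x := fun x hx =>
    ((hf.contDiffAt (hs.mem_nhds hx)).differentiableAt (by simp)).hasDerivAt
  have hAs : ContDiffOn ℝ ∞ A s := by
    rw [contDiffOn_infty_iff_deriv_of_isOpen hs]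
    refine ⟨fun x hx => (hA x hx).differentiableAt.differentiableWithinAt, ?_⟩
    refine ContDiffOn.congr (f := fun x => 1 / √(σ * f x)) ?_ fun x hx => (hA' x hx).deriv
    exact contDiffOn_const.div ((contDiffOn_const.mul hf).sqrt fun x hx => (hpos x hx).ne')
      fun x hx => (Real.sqrt_pos.2 (hpos x hx)).ne'
  refine ⟨fun x => 2 * σ * (A x * (√(σ * f x))⁻¹), fun x => 2 * σ * (1 / √(σ * f x) * (√(σ * f x))⁻¹
    + A x * (-(σ * deriv f x / (2 * √(σ * f x))) / √(σ * f x) ^ 2)),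
    contDiffOn_const.mul (hAs.pow 2), fun x hx => ?_, fun x hx => ?_, fun x hx => ?_⟩
  · exact (((hA' x hx).pow 2).const_mul σ).congr_deriv (by simp; ring)
  · exact ((hA' x hx).mul ((((hd x hx).const_mul σ).sqrt (hpos x hx).ne').inv
      (Real.sqrt_pos.2 (hpos x hx)).ne')).const_mul (2 * σ)
  · have hr := Real.sqrt_pos.2 (hpos x hx)
    have hr2 := Real.sq_sqrt (hpos x hx).le
    have hf2 : f x = σ * √(σ * f x) ^ 2 := by rw [hr2, ← mul_assoc, ← sq, hσ, one_mul]
    generalize √(σ * f x) = r at *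
    rw [hf2]
    field_simp
    linear_combination (2 * r - σ * A x * deriv f x) * hσ

theorem isHamiltonianSystem_gasDensity (hI : ∀ i, IsOpen (I i)) (hc : ∀ i, (I i).OrdConnected)
    (hF : IsNondegParam I F) {A B : ℝ → ℝ} (hA : ∀ s ∈ I 0, HasDerivAt A (1 / √|F 0 s|) s)
    (hB : ∀ s ∈ I 1, HasDerivAt B (1 / √|F 1 s|) s) :
    IsHamiltonianSystem (dom I) speed (gasOp F) (gasDensity F A B) := by
  obtain ⟨σ, hσ, hσF⟩ := exists_sign (hc 0) (hF.1 0).continuousOn (hF.2 0)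
  obtain ⟨τ, hτ, hτF⟩ := exists_sign (hc 1) (hF.1 1).continuousOn (hF.2 1)
  obtain ⟨α₁, α₂, hα⟩ := isProfile_sq (hI 0) hσ (hF.1 0) (hF.2 0) (fun x hx => (hσF x hx).2) hA
  obtain ⟨β₁, β₂, hβ⟩ := isProfile_sq (hI 1) hτ (hF.1 1) (hF.2 1) (fun x hx => (hτF x hx).2) hB
  refine isHamiltonianSystem_gasOp hI hF.1 hα hβ fun q hq => ?_
  rw [gasDensity, (hσF _ (hq.1 0)).1, (hτF _ (hq.1 1)).1]
  ring

/-! ### The flat case -/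

theorem IsFlatParam.exists_localDensity (hI : ∀ i, IsOpen (I i)) (hne : ∀ i, (I i).Nonempty)
    (hF : IsNondegParam I F) (hflat : IsFlatParam I F) :
    ∃ h, IsHamiltonianSystem (dom I) speed (gasOp F).localPart h := by
  have hw : ∀ p ∈ dom I, tailSpeed F p = 0 := fun p hp => hflat.tailSpeed_eq_zero hI hp
  obtain ⟨ε, α, β, γ, h0, hf, hφ, hψ⟩ := hflat
  have hd : ∀ {i : Fin 3} {e c : ℝ}, (∀ s ∈ I i, F i s = e * s + c) →
      ∀ s ∈ I i, deriv (F i) s = e := fun {i e c} h s hs => by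
    have h1 : HasDerivAt (fun s : ℝ => e * s + c) e s := by
      simpa using ((hasDerivAt_id s).const_mul e).add_const c
    exact (h1.congr_of_eventuallyEq (eventually_of_mem ((hI i).mem_nhds hs) h)).deriv
  have hS : ∀ p ∈ dom I, trail F p = -(1 / 2) * ε * b p := by
    intro p hp
    rw [trail, Fin.sum_univ_three, hf _ (hp.1 0), hφ _ (hp.1 1), hψ _ (hp.1 2)]
    simp [slope, b]
    linear_combination (1 / 2) * h0
  rcases eq_or_ne ε 0 with rfl | hε
  · have hα : α ≠ 0 := fun h => by
      obtain ⟨s, hs⟩ := hne 0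
      exact hF.2 0 s hs (by rw [hf s hs, h]; ring)
    have hβ : β ≠ 0 := fun h => by
      obtain ⟨s, hs⟩ := hne 1
      exact hF.2 1 s hs (by rw [hφ s hs, h]; ring)
    have key : ∀ {i : Fin 3} {c : ℝ}, c ≠ 0 → (∀ s ∈ I i, F i s = 0 * s + c) →
        IsProfile (I i) (F i) (fun s => s ^ 2 / c) (fun s => 2 * s / c) (fun _ => 2 / c) :=
      fun {i c} hc h => ⟨ContDiff.contDiffOn (by fun_prop),
        fun s _ => ((hasDerivAt_pow 2 s).div_const c).congr_deriv (by simp),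
        fun s _ => (((hasDerivAt_id s).const_mul 2).div_const c).congr_deriv (by simp),
        fun s hs => by rw [h s hs, hd h s hs]; field_simp; ring⟩
    have hφ' : ∀ s ∈ I 1, F 1 s = 0 * s + β := fun s hs => by rw [hφ s hs]; ring
    refine ⟨fun q => (1 / 4) * ((q 0 ^ 2 / α - q 1 ^ 2 / β) * (b q)⁻¹),
      isHamiltonianSystem_localPart hI (key hα hf) (key hβ hφ') (fun _ _ => rfl) hw fun p hp => ?_⟩
    rw [tailPotential, hS p hp, hf _ (hp.1 0), hφ' _ (hp.1 1)]
    field_simp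
    ring
  · have key : ∀ {i : Fin 3} {e c : ℝ} (k : ℝ), e ≠ 0 → (∀ s ∈ I i, F i s = e * s + c) →
        IsProfile (I i) (F i) (fun s => 4 * (e * s + c) / e ^ 2 + k) (fun _ => 4 / e)
          (fun _ => 0) :=
      fun {i e c} k he h => ⟨ContDiff.contDiffOn (by fun_prop),
        fun s _ => ((((((hasDerivAt_id s).const_mul e).add_const c).const_mul 4).div_const
          (e ^ 2)).add_const k).congr_deriv (by field_simp),
        fun s _ => hasDerivAt_const s _,
        fun s hs => by rw [h s hs, hd h s hs]; field_simp; ring⟩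
    -- Profiles may be shifted by constants. The shift `4 (α - β) / ε²` is the one that makes the
    -- tail potential zero; with it the first profile need not be the signed square of a primitive.
    refine ⟨fun q => (1 / 4) * ((4 * (ε * q 0 + α) / ε ^ 2 + 4 * (α - β) / ε ^ 2
      - (4 * (-ε * q 1 + β) / (-ε) ^ 2 + 0)) * (b q)⁻¹),
      isHamiltonianSystem_localPart hI (key _ hε hf) (key _ (neg_ne_zero.2 hε) hφ) (fun _ _ => rfl)
        hw fun p hp => ?_⟩
    have hb : b p ≠ 0 := hp.2
    rw [tailPotential, hS p hp, hf _ (hp.1 0), hφ _ (hp.1 1)]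
    field_simp
    ring

theorem represents_localPart (hw : ∀ p ∈ dom I, tailSpeed F p = 0) :
    Represents I (gasOp F).localPart.toOp F := by
  intro u ξ _ _ hD x hx
  have ht : tail F u ξ x = 0 := by
    have : (fun y => ∑ j, tailSpeed F (u y) j * deriv u y j * ξ y j) = fun _ => 0 := by
      funext y
      by_cases hy : y ∈ tsupport ξ
      · simp [hw _ (hD y hy)]
      · simp [image_eq_zero_of_notMem_tsupport hy]
    simp [tail, this, Dinv]
  funext i
  have h := act_gasOp_eq_localPart F u ξ (fun m : Fin 2 => Dinv fun y => ∑ j,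
    (![fun _ _ => 1, tailSpeed F] : Fin 2 → Pt → Pt) m (u y) j * deriv u y j * ξ y j)
    (fun m => Fin.elim0 m) x i
  have h1 : Dinv (fun y => ∑ j, (![fun _ _ => 1, tailSpeed F] : Fin 2 → Pt → Pt) 1 (u y) j
    * deriv u y j * ξ y j) x = 0 := ht
  rw [h1, hw _ hx] at h
  rw [Pi.zero_apply, mul_zero, zero_mul, zero_mul, add_zero, add_zero] at h
  refine Eq.trans ?_ h.symm
  unfold HydroOp.toOp
  congr 2
  funext m
  exact Fin.elim0 m

/-! ### Infinitely many operators, and three local ones -/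

theorem infinite_nonflat (hI : ∀ i, IsOpen (I i)) (hc : ∀ i, (I i).OrdConnected)
    (hne : ∀ i, (I i).Nonempty) :
    {T | ∃ F, IsNondegParam I F ∧ ¬ IsFlatOn (gasMetric F) (dom I) ∧
      T = restrict (dom I) (gasOp F).toOp}.Infinite := by
  -- For equal positive constants `c` flatness would require `α + β + 4γ = 6c` to vanish.
  let C : ℕ → Fin 3 → ℝ → ℝ := fun n _ _ => (n : ℝ) + 1
  have hC : ∀ n, IsNondegParam I (C n) := fun n =>
    ⟨fun i => contDiffOn_const, fun i s _ => by positivity⟩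
  refine Set.infinite_of_injective_forall_mem (f := fun n => restrict (dom I) (gasOp (C n)).toOp)
    (fun m n hmn => ?_) fun n => ⟨C n, hC n, fun hflat => ?_, rfl⟩
  · obtain ⟨s, hs⟩ := hne 0
    have h : (m : ℝ) + 1 = n + 1 := eqOn_of_restrict_eq hI hne hmn 0 hs
    exact_mod_cast add_right_cancel h
  · obtain ⟨ε, α, β, γ, h0, hf, hφ, hψ⟩ := (isFlatOn_gasMetric_iff hI hc hne (hC n)).1 hflat
    obtain ⟨s, hs⟩ := hne 0
    have hε : ε = 0 := by
      obtain ⟨t, ht⟩ := Filter.nonempty_of_mem (inter_mem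
        (mem_nhdsWithin_of_mem_nhds ((hI 0).mem_nhds hs)) (self_mem_nhdsWithin (a := s) (s := {s}ᶜ)))
      have h1 := (hf s hs).symm.trans (hf t ht.1)
      have h2 : ε * (s - t) = 0 := by linarith
      exact (mul_eq_zero.1 h2).resolve_right (sub_ne_zero.2 (Ne.symm ht.2))
    obtain ⟨t, ht⟩ := hne 1
    obtain ⟨r, hr⟩ := hne 2
    have h1 := hf s hs
    have h2 := hφ t ht
    have h3 := hψ r hr
    have hn : (0:ℝ) ≤ n := n.cast_nonneg
    simp only [C, hε] at h1 h2 h3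
    linarith

/-- The parameters of the flat metrics with the constants `ε, α, β`. -/
noncomputable def flatParam (ε α β : ℝ) : Fin 3 → ℝ → ℝ :=
  ![fun s => ε * s + α, fun s => -ε * s + β, fun s => -(ε / 2) * s + -(α + β) / 4]

theorem isParam_flatParam (ε α β : ℝ) : IsParam I (flatParam ε α β) := by
  intro i
  fin_cases i <;> exact ContDiff.contDiffOn (by simp [flatParam]; fun_prop)

theorem isFlatParam_flatParam (ε α β : ℝ) : IsFlatParam I (flatParam ε α β) :=
  ⟨ε, α, β, -(α + β) / 4, by ring, fun _ _ => rfl, fun _ _ => rfl, fun _ _ => rfl⟩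

theorem exists_three_local (hI : ∀ i, IsOpen (I i)) (hc : ∀ i, (I i).OrdConnected)
    (hne : ∀ i, (I i).Nonempty) (hbd : ∀ i, Bornology.IsBounded (I i)) :
    ∃ G : Fin 3 → Fin 3 → ℝ → ℝ,
      (∀ m, IsNondegParam I (G m) ∧ IsFlatOn (gasMetric (G m)) (dom I)) ∧
      LinearIndependent ℝ (fun m => restrict (dom I) (gasOp (G m)).toOp) ∧
      ∀ F, IsNondegParam I F → IsFlatOn (gasMetric F) (dom I) →
        restrict (dom I) (gasOp F).toOp ∈
          Submodule.span ℝ (Set.range fun m => restrict (dom I) (gasOp (G m)).toOp) := by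
  obtain ⟨N, hN⟩ : ∃ N : ℝ, ∀ i, ∀ s ∈ I i, |s| < N := by
    choose r hr using fun i => (hbd i).subset_ball (0 : ℝ)
    refine ⟨max (r 0) (max (r 1) (r 2)), fun i s hs => ?_⟩
    have h := hr i hs
    rw [Metric.mem_ball, Real.dist_eq, sub_zero] at h
    fin_cases i <;> simp at h ⊢ <;> tauto
  -- The first two triples are the constants `(1, -5, 1)` and `(1, 3, -1)`. In the third, `|s| < N`
  -- makes `s + N` and `-s + 3N` positive and `-s/2 - N` negative.
  let G : Fin 3 → Fin 3 → ℝ → ℝ := ![flatParam 0 1 (-5), flatParam 0 1 3, flatParam 1 N (3 * N)]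
  have hGp : ∀ m, IsParam I (G m) := fun m => by
    fin_cases m <;> exact isParam_flatParam _ _ _
  have hGf : ∀ m, IsFlatParam I (G m) := fun m => by
    fin_cases m <;> exact isFlatParam_flatParam _ _ _
  have hG : ∀ m, IsNondegParam I (G m) := fun m => ⟨hGp m, fun i s hs => by
    have h := abs_lt.1 (hN i s hs)
    fin_cases m <;> fin_cases i <;> simp [G, flatParam] <;> try norm_num
    · intro h'; linarith
    · intro h'; linarith
    · intro h'; linarith⟩
  have hrep : ∀ (c : Fin 3 → ℝ) {F : Fin 3 → ℝ → ℝ},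
      (∀ i, Set.EqOn (F i) (fun s => ∑ m, c m * G m i s) (I i)) →
      restrict (dom I) (gasOp F).toOp = ∑ m, c m • restrict (dom I) (gasOp (G m)).toOp :=
    fun c F hF => by
      rw [sum_smul_restrict]
      exact ((represents_sum hI c hGp hF).restrict_eq).symm
  refine ⟨G, fun m => ⟨hG m, (isFlatOn_gasMetric_iff hI hc hne (hG m)).2 (hGf m)⟩, ?_, ?_⟩
  · rw [Fintype.linearIndependent_iff]
    intro c hsum
    have h0 : restrict (dom I) (gasOp fun i s => ∑ m, c m * G m i s).toOp
        = restrict (dom I) (gasOp fun _ _ => 0).toOp := by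
      rw [hrep c fun i s _ => rfl, hsum, hrep 0 fun i s _ => by simp]
      simp
    have h := eqOn_of_restrict_eq hI hne h0
    obtain ⟨s, hs⟩ := hne 0
    obtain ⟨t, ht⟩ := Filter.nonempty_of_mem (inter_mem
      (mem_nhdsWithin_of_mem_nhds ((hI 0).mem_nhds hs)) (self_mem_nhdsWithin (a := s) (s := {s}ᶜ)))
    obtain ⟨r, hr⟩ := hne 1
    have e1 := h 0 hs
    have e2 := h 0 ht.1
    have e3 := h 1 hr
    simp [Fin.sum_univ_three, G, flatParam] at e1 e2 e3
    have c2 : c 2 = 0 := by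
      have : c 2 * (s - t) = 0 := by linarith
      exact (mul_eq_zero.1 this).resolve_right (sub_ne_zero.2 (Ne.symm ht.2))
    rw [c2] at e1 e3
    intro m
    fin_cases m
    · simp; linarith
    · simp; linarith
    · exact c2
  · intro F hF hflat
    obtain ⟨ε, α, β, γ, h0, hf, hφ, hψ⟩ := (isFlatOn_gasMetric_iff hI hc hne hF).1 hflat
    -- The slope forces the third coefficient to be `ε`. The other two solve `c₀ + c₁ = α - εN` and
    -- `-5c₀ + 3c₁ = β - 3εN`.
    rw [hrep ![(3 * (α - ε * N) - (β - 3 * ε * N)) / 8, (5 * (α - ε * N) + (β - 3 * ε * N)) / 8, ε]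
      fun i s hs => ?_]
    · exact Submodule.sum_mem _ fun m _ => Submodule.smul_mem _ _ (Submodule.subset_span ⟨m, rfl⟩)
    · fin_cases i
      · simp [hf s hs, Fin.sum_univ_three, G, flatParam]; ring
      · simp [hφ s hs, Fin.sum_univ_three, G, flatParam]; ring
      · simp [hψ s hs, Fin.sum_univ_three, G, flatParam]; linear_combination (1 / 4) * h0

end HydroType

open HydroType
theorem mainTheorem8 (I : Fin 3 → Set ℝ) (hopen : ∀ i, IsOpen (I i))
    (hint : ∀ i, (I i).OrdConnected) (hne : ∀ i, (I i).Nonempty) :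
    -- the system is gas dynamics with `P = s - 1/ρ` in Riemann invariants
    (∀ (ρ c s : ℝ × ℝ → ℝ) (z : ℝ × ℝ), DifferentiableAt ℝ ρ z → DifferentiableAt ℝ c z →
      DifferentiableAt ℝ s z → ρ z ≠ 0 →
      (GasEquations ρ c s z ↔
        RiemannEquations ![fun y => -c y + s y - 1 / ρ y, fun y => -c y - s y + 1 / ρ y, s] z)) ∧
    -- the operators are Hamiltonian, and the tail consists of commuting flows
    (∀ F, IsParam I F → IsHamiltonian (dom I) (gasOp F).toOp ∧
      FlowsCommute (dom I) speed (tailSpeed F)) ∧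
    -- they are mutually compatible
    (∀ F G, IsParam I F → IsParam I G →
      AreCompatible (dom I) (gasOp F).toOp (gasOp G).toOp) ∧
    -- different parameters give different operators
    (∀ F G, IsParam I F → IsParam I G →
      restrict (dom I) (gasOp F).toOp = restrict (dom I) (gasOp G).toOp →
      ∀ i, Set.EqOn (F i) (G i) (I i)) ∧
    -- infinitely many of them have a nondegenerate metric that is not flat
    {T | ∃ F, IsNondegParam I F ∧ ¬ IsFlatOn (gasMetric F) (dom I) ∧
      T = restrict (dom I) (gasOp F).toOp}.Infinite ∧
    (∀ F, IsNondegParam I F →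
      -- the local part is generated by the metric, which is conformally flat
      (gasOp F).IsGeneratedBy (gasMetric F) (dom I) ∧
      IsConformallyFlatOn (gasMetric F) (dom I) ∧
      -- the system is Hamiltonian with the stated density
      (∀ A B : ℝ → ℝ, (∀ s ∈ I 0, HasDerivAt A (1 / √|F 0 s|) s) →
        (∀ s ∈ I 1, HasDerivAt B (1 / √|F 1 s|) s) →
        IsHamiltonianSystem (dom I) speed (gasOp F) (gasDensity F A B)) ∧
      -- criterion of flatness
      (IsFlatOn (gasMetric F) (dom I) ↔ IsFlatParam I F) ∧
      -- in the flat case the operator is local and the system has a local Hamiltonian structure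
      (IsFlatOn (gasMetric F) (dom I) →
        (∀ p ∈ dom I, tailSpeed F p = 0) ∧
        restrict (dom I) (gasOp F).toOp = restrict (dom I) (gasOp F).localPart.toOp ∧
        IsHamiltonian (dom I) (gasOp F).localPart.toOp ∧
        ∃ h, IsHamiltonianSystem (dom I) speed (gasOp F).localPart h)) ∧
    -- there are exactly three linearly independent local structures
    ((∀ i, Bornology.IsBounded (I i)) → ∃ G : Fin 3 → Fin 3 → ℝ → ℝ,
      (∀ m, IsNondegParam I (G m) ∧ IsFlatOn (gasMetric (G m)) (dom I)) ∧
      LinearIndependent ℝ (fun m => restrict (dom I) (gasOp (G m)).toOp) ∧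
      ∀ F, IsNondegParam I F → IsFlatOn (gasMetric F) (dom I) →
        restrict (dom I) (gasOp F).toOp ∈
          Submodule.span ℝ (Set.range fun m => restrict (dom I) (gasOp (G m)).toOp)) := by
  refine ⟨fun ρ c s z => gasEquations_iff,
    fun F hF => ⟨(represents_gasOp F).isHamiltonian hopen hF, flowsCommute_tailSpeed hopen hF⟩,
    fun F G => areCompatible_gasOp hopen,
    fun F G _ _ h => eqOn_of_restrict_eq hopen hne h,
    infinite_nonflat hopen hint hne,
    fun F hF => ⟨isGeneratedBy_gasMetric hopen hF, isConformallyFlatOn_gasMetric hopen hF,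
      fun A B => isHamiltonianSystem_gasDensity hopen hint hF,
      isFlatOn_gasMetric_iff hopen hint hne hF, fun hflat => ?_⟩,
    exists_three_local hopen hint hne⟩
  have hp := (isFlatOn_gasMetric_iff hopen hint hne hF).1 hflat
  have hw : ∀ p ∈ dom I, tailSpeed F p = 0 := fun p => hp.tailSpeed_eq_zero hopen
  exact ⟨hw, (represents_localPart hw).restrict_eq.symm,
    (represents_localPart hw).isHamiltonian hopen hF.1, hp.exists_localDensity hopen hne hF⟩
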